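/- **Setting.** Let $\hbar\in\mathbb C\setminus\{0\}$, $r\ge 3$ and $g=r-3$. Irregular times are $t=(t_1,\dots,t_{2r-2})\in\mathbb C^{2r-2}$, with $t_{2r-3}\neq 0$. Put $\partial_\lambda$ for the $\lambda$-derivative, $z=\lambda^{1/2}$. *Isomonodromic families.* Let $U\subseteq\mathbb C^{2r-2}$ be open. We consider families $\tilde L(\lambda,t)$, $t\in U$, of $2\times2$ matrices, polynomial in $\lambda$ with coefficients holomorphic in $t$, such that for every $t\in U$: 1. $\tilde L=\begin{pmatrix}-\frac12t_{2r-2}&0\\ \frac14t_{2r-3}^2&-\frac12t_{2r-2}\end{pmatrix}\lambda^{r-2}+\begin{pmatrix}-\frac12t_{2r-4}&1\\ \delta&-\frac12t_{2r-4}\end{pmatrix}\lambda^{r-3}+O(\lambda^{r-4})$ for some $\delta\in\mathbb C$. 2. $\tilde L$ has irregular type $t$ at infinity: there is an invertible formal gauge matrix $G(z)=G_{-1}z+G_0+G_1z^{-1}+\cdots$ with $G_{-1}$ of rank $1$ such that $G\tilde LG^{-1}+\hbar(\partial_\lambda G)G^{-1}=\operatorname{diag}\Big(-\frac12\sum_{k=1}^{2r-2}t_kz^{k-2}+\frac{\hbar}{4z^2},\,-\frac12\sum_{k=1}^{2r-2}(-1)^kt_kz^{k-2}+\frac{\hbar}{4z^2}\Big)+O(z^{-3})$.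 3. For every $k$ there is a matrix $A_k(\lambda)$, polynomial in $\lambda$, with $\hbar\,\partial_{t_k}\tilde L=[A_k,\tilde L]+\hbar\,\partial_\lambda A_k$ (compatibility of the Lax pair $\hbar\partial_\lambda\Psi=\tilde L\Psi$, $\hbar\partial_{t_k}\Psi=A_k\Psi$). The Darboux coordinates are holomorphic functions $q_1,\dots,q_g$ on $U$ with $[\tilde L(\lambda,t)]_{1,2}=\prod_{j=1}^g(\lambda-q_j)$, and $p_j=[\tilde L(q_j,t)]_{1,1}$. Put $\tilde P_1(\lambda)=-\sum_{j=0}^{r-2}t_{2j+2}\lambda^j$. *Times.* Let $s$ be a holomorphic function on $U$ with $s^{2r-3}=\frac12t_{2r-3}$, and read $(\frac12t_{2r-3})^{m/(2r-3)}$ as $s^m$ for $m\in\mathbb Z$. The $g+4$ trivial times are $T_{\infty,k}=t_{2k}$ ($1\le k\le r-1$), $T_2=s^2$ and $T_1=\frac{t_{2r-5}}{2r-5}s^{-(2r-5)}$. The isomonodromic times are, for $1\le k\le g$, $$\tau_k=\sum_{i=0}^{k-1}\frac{(-1)^i\prod_{m=1}^i(2r-2k+2m-7)\,(\frac12t_{2r-5})^i\,s^{-((2r-3)i+2r-5-2k)}\,\frac12t_{2r-5-2k+2i}}{i!\,(2r-5)^i}+\frac{(-1)^k\prod_{m=1}^k(2r-2k+2m-7)\,(\frac12t_{2r-5})^{k+1}s^{-(k+1)(2r-5)}}{(k+1)(k-1)!\,(2r-5)^k}.$$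 The shifted Darboux coordinates are $\check q_j=T_2q_j+T_1$ and $\check p_j=T_2^{-1}\big(p_j-\frac12\tilde P_1(q_j)\big)$. *Trivial deformations.* For $\alpha\in\mathbb C^{2r-2}$ (possibly depending on $t$) let $\mathcal L_\alpha=\hbar\sum_k\alpha_k\partial_{t_k}$. Let $w_k=e_{2k}$ ($1\le k\le r-1$), $u_{-1}=\frac12\sum_{m=1}^{2r-2}m\,t_m e_m$, $u_0=\frac12\sum_{m=1}^{2r-4}m\,t_{m+2}e_m$. A function $f$ is *annihilated by the trivial deformations* on $U$ if $\mathcal L_{w_k}f=0$ for all $1\le k\le r-1$ and $\mathcal L_{u_{-1}}f=\mathcal L_{u_0}f=0$ on $U$. Say that $f$ is *a function of the isomonodromic times on $U$* if every point of $U$ has an open neighbourhood $V\subseteq U$ on which $f=u(\tau_1,\dots,\tau_g)$ with $u$ holomorphic on $\tau(V)$, and if the same holds on every open $V\subseteq U$ for which all level sets of $\tau=(\tau_1,\dots,\tau_g)$ in $V$ are connected (or empty). **Theorem.** For all such $U$ and $s$: (i) At every point of $U$ the differential of $(T_{\infty,1},\dots,T_{\infty,r-1},T_1,T_2,\tau_1,\dots,\tau_g)$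 is bijective, so that these are local coordinates. For every family $\tilde L$ as above and all $j$, the functions $\check q_j$ and $\check p_j$ are independent of the trivial times, that is, their partial derivatives with respect to $T_{\infty,1},\dots,T_{\infty,r-1},T_1,T_2$ in these coordinates vanish on $U$; and they are functions of the isomonodromic times on $U$. (ii) A holomorphic function $f$ on $U$ is annihilated by the trivial deformations on $U$ if and only if it is a function of the isomonodromic times on $U$. (iii) Let $D$ be the set of all $t\in\mathbb C^{2r-2}$ for which $t_{2r-3}$ is not a non-positive real number, with $s$ the principal branch. A holomorphic function $f$ on $D$ is annihilated by the trivial deformations on $D$ if and only if $f=u(\tau_1,\dots,\tau_g)$ on $D$ for an entire function $u:\mathbb C^g\to\mathbb C$. -/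

import Mathlib

noncomputable section

namespace TwistedIsomonodromy

open Polynomial

/-! Throughout, the pole order at infinity is `r = g + 3` with `g : ℕ` (so `r ≥ 3` and `g` is the
genus of the spectral curve); thus `2 r - 2 = 2 g + 4`, `2 r - 3 = 2 g + 3`, `2 r - 5 = 2 g + 1`. -/

/-- The space of irregular times `(t_1, …, t_{2g+4})`. -/
abbrev IrregularTimes (g : ℕ) : Type := Fin (2 * g + 4) → ℂ

/-- The `k`-th irregular time `t_k`, with the 1-based index `1 ≤ k ≤ 2g+4` (and `0` outside
this range). -/
def irregTime {g : ℕ} (t : IrregularTimes g) (k : ℕ) : ℂ :=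
  if h : 1 ≤ k ∧ k ≤ 2 * g + 4 then t ⟨k - 1, by omega⟩ else 0

/-! ### Connections normalized at infinity and their irregular type -/

/-- `L(λ)` is a polynomial `2 × 2` matrix of degree at most `r - 2 = g + 1`, normalized at infinity:
its two leading coefficients are
`[-t_{2r-2}/2, 0; t_{2r-3}²/4, -t_{2r-2}/2]` and `[-t_{2r-4}/2, 1; δ, -t_{2r-4}/2]`. -/
structure IsNormalizedAtInfinity {g : ℕ} (t : IrregularTimes g)
    (L : Matrix (Fin 2) (Fin 2) ℂ[X]) : Prop where
  natDegree_le : ∀ a b, (L a b).natDegree ≤ g + 1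
  leading : L.map (fun P => P.coeff (g + 1)) =
    !![-(irregTime t (2 * g + 4)) / 2, 0;
       (irregTime t (2 * g + 3)) ^ 2 / 4, -(irregTime t (2 * g + 4)) / 2]
  subleading : ∃ δ : ℂ, L.map (fun P => P.coeff g) =
    !![-(irregTime t (2 * g + 2)) / 2, 1;
       δ, -(irregTime t (2 * g + 2)) / 2]

/-- The derivation `∂_λ` on formal Laurent series in `w = z⁻¹`, where `λ = z² = w⁻²`, that is
`∂_λ = -(1/2) w³ ∂_w`. -/
def derivLambda (F : LaurentSeries ℂ) : LaurentSeries ℂ :=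
  HahnSeries.single (3 : ℤ) (-1 / 2 : ℂ) * LaurentSeries.derivative ℂ F

/-- A polynomial matrix in `λ` viewed as a matrix of Laurent series in `w = z⁻¹`, `λ = w⁻²`. -/
def toLaurent (L : Matrix (Fin 2) (Fin 2) ℂ[X]) : Matrix (Fin 2) (Fin 2) (LaurentSeries ℂ) :=
  L.map (Polynomial.aeval (HahnSeries.single (-2 : ℤ) (1 : ℂ)))

/-- `-(1/2) ∑_{k=1}^{2r-2} ε^k t_k z^{k-2} + ħ / (4 z²)`, as a Laurent series in `w = z⁻¹`;
`ε = 1` and `ε = -1` are the two sheets of the double cover `λ = z²`. -/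
def irregularPart {g : ℕ} (ħ : ℂ) (t : IrregularTimes g) (ε : ℂ) : LaurentSeries ℂ :=
  (∑ k ∈ Finset.Icc 1 (2 * g + 4),
    HahnSeries.single (2 - (k : ℤ)) (-(1 / 2) * ε ^ k * irregTime t k)) +
  HahnSeries.single (2 : ℤ) (ħ / 4)

/-- `L(λ)` has (twisted) irregular type `t` at infinity: there is a formal gauge transformation
`G(z) = G_{-1} z + G_0 + G_1 z⁻¹ + ⋯` with `G_{-1}` of rank one, invertible over the Laurent series,
such that `L_∞ = G L G⁻¹ + ħ (∂_λ G) G⁻¹` equals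
`diag(-(1/2) ∑ t_k z^{k-2} + ħ/(4z²), -(1/2) ∑ (-1)^k t_k z^{k-2} + ħ/(4z²)) + O(z⁻³)`.
(Note that `O(z⁻³) dλ` is exactly the regular part at infinity, since `dλ = -2 w⁻³ dw`.) -/
def HasIrregularType {g : ℕ} (ħ : ℂ) (t : IrregularTimes g)
    (L : Matrix (Fin 2) (Fin 2) ℂ[X]) : Prop :=
  ∃ G Linf : Matrix (Fin 2) (Fin 2) (LaurentSeries ℂ),
    (∀ a b, ∀ n : ℤ, n < -1 → (G a b).coeff n = 0) ∧
    (G.map (fun F => F.coeff (-1))).rank = 1 ∧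
    G.det ≠ 0 ∧
    G * toLaurent L + ħ • G.map derivLambda = Linf * G ∧
    ∀ a b, ∀ n : ℤ, n < 3 →
      ((Linf - Matrix.diagonal ![irregularPart ħ t 1, irregularPart ħ t (-1)]) a b).coeff n = 0

/-! ### Isomonodromic families and Darboux coordinates -/

/-- `∂_{t_k}` of a scalar function on the space of irregular times (`k` 0-based). -/
def pderivTime {g : ℕ} (k : Fin (2 * g + 4)) (f : IrregularTimes g → ℂ) (t : IrregularTimes g) :
    ℂ :=
  fderiv ℂ f t (Pi.single k 1)

/-- A family `L(λ, t)`, `t ∈ U`, of connections normalized at infinity, of irregular type `t`,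
which depends holomorphically on `t` and is isomonodromic: for each irregular time there is an
auxiliary matrix `A(λ)`, polynomial in `λ`, such that the Lax pair
`ħ ∂_λ Ψ = L Ψ`, `ħ ∂_{t_k} Ψ = A Ψ` is compatible, i.e.
`ħ ∂_{t_k} L = [A, L] + ħ ∂_λ A` (written here coefficient by coefficient in `λ`). -/
structure IsIsomonodromicFamily {g : ℕ} (ħ : ℂ) (U : Set (IrregularTimes g))
    (L : IrregularTimes g → Matrix (Fin 2) (Fin 2) ℂ[X]) : Prop where
  normalized : ∀ t ∈ U, IsNormalizedAtInfinity t (L t)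
  irregularType : ∀ t ∈ U, HasIrregularType ħ t (L t)
  differentiableOn : ∀ a b m, DifferentiableOn ℂ (fun t => (L t a b).coeff m) U
  lax : ∀ t ∈ U, ∀ k : Fin (2 * g + 4), ∃ A : Matrix (Fin 2) (Fin 2) ℂ[X], ∀ a b m,
    ħ * pderivTime k (fun t' => (L t' a b).coeff m) t =
      ((A * L t - L t * A) a b).coeff m + ħ * (derivative (A a b)).coeff m

/-- The functions `q_1, …, q_g` on `U` are the zeros of the entry `[L(λ, t)]_{1,2}` (a monic
polynomial of degree `g` in `λ`), labelled holomorphically in `t`. -/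
structure IsDarbouxPosition {g : ℕ} (U : Set (IrregularTimes g))
    (L : IrregularTimes g → Matrix (Fin 2) (Fin 2) ℂ[X]) (q : Fin g → IrregularTimes g → ℂ) :
    Prop where
  zeros : ∀ t ∈ U, L t 0 1 = ∏ j, (X - C (q j t))
  differentiableOn : ∀ j, DifferentiableOn ℂ (q j) U

/-- The conjugate coordinates `p_j = [L(q_j, t)]_{1,1}`. -/
def darbouxMomentum {g : ℕ} (L : IrregularTimes g → Matrix (Fin 2) (Fin 2) ℂ[X])
    (q : Fin g → IrregularTimes g → ℂ) (j : Fin g) (t : IrregularTimes g) : ℂ :=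
  (L t 0 0).eval (q j t)

/-! ### Trivial and isomonodromic times -/

/-- `s` is a holomorphic branch on `U` of the root `(t_{2r-3}/2)^{1/(2r-3)}`, with `t_{2r-3} ≠ 0`.
The fractional powers `(t_{2r-3}/2)^{m/(2r-3)}` are then the integer powers `s^m`. -/
structure IsRootBranch {g : ℕ} (U : Set (IrregularTimes g)) (s : IrregularTimes g → ℂ) : Prop where
  ne_zero : ∀ t ∈ U, irregTime t (2 * g + 3) ≠ 0
  pow_eq : ∀ t ∈ U, s t ^ (2 * g + 3) = irregTime t (2 * g + 3) / 2
  differentiableOn : DifferentiableOn ℂ s U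

/-- `T₂ = (t_{2r-3}/2)^{2/(2r-3)}`. -/
def timeT2 {g : ℕ} (s : IrregularTimes g → ℂ) (t : IrregularTimes g) : ℂ := s t ^ 2

/-- `T₁ = t_{2r-5}/(2r-5) · (t_{2r-3}/2)^{-(2r-5)/(2r-3)}`. -/
def timeT1 {g : ℕ} (s : IrregularTimes g → ℂ) (t : IrregularTimes g) : ℂ :=
  irregTime t (2 * g + 1) / (2 * g + 1) * (s t ^ (2 * g + 1))⁻¹

/-- The isomonodromic time `τ_k` for `1 ≤ k ≤ g`. -/
def isoTimeAux {g : ℕ} (s : IrregularTimes g → ℂ) (k : ℕ) (t : IrregularTimes g) : ℂ :=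
  (∑ i ∈ Finset.range k,
    (-1) ^ i * (∏ m ∈ Finset.Icc 1 i, (2 * (g : ℂ) - 2 * k + 2 * m - 1)) *
      (irregTime t (2 * g + 1) / 2) ^ i *
      (s t ^ ((2 * g + 3) * i + (2 * g + 1 - 2 * k)))⁻¹ *
      (irregTime t (2 * g + 1 - 2 * k + 2 * i) / 2) /
      ((i.factorial : ℂ) * (2 * (g : ℂ) + 1) ^ i)) +
  (-1) ^ k * (∏ m ∈ Finset.Icc 1 k, (2 * (g : ℂ) - 2 * k + 2 * m - 1)) *
    (irregTime t (2 * g + 1) / 2) ^ (k + 1) *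
    (s t ^ ((k + 1) * (2 * g + 1)))⁻¹ /
    (((k : ℂ) + 1) * ((k - 1).factorial : ℂ) * (2 * (g : ℂ) + 1) ^ k)

/-- The isomonodromic times `(τ_1, …, τ_g)`. -/
def isoTimes {g : ℕ} (s : IrregularTimes g → ℂ) (t : IrregularTimes g) : Fin g → ℂ :=
  fun k => isoTimeAux s (k.val + 1) t

/-- The `g + 4` trivial times `T_{∞,1} = t_2, …, T_{∞,r-1} = t_{2r-2}` and `T₁`, `T₂`. -/
def trivialTimes {g : ℕ} (s : IrregularTimes g → ℂ) (t : IrregularTimes g) :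
    Fin (g + 2) ⊕ Fin 2 → ℂ :=
  Sum.elim (fun k => irregTime t (2 * (k.val + 1))) ![timeT1 s t, timeT2 s t]

/-- All new times: the trivial and the isomonodromic ones. -/
def allTimes {g : ℕ} (s : IrregularTimes g → ℂ) (t : IrregularTimes g) :
    (Fin (g + 2) ⊕ Fin 2) ⊕ Fin g → ℂ :=
  Sum.elim (trivialTimes s t) (isoTimes s t)

/-! ### Shifted Darboux coordinates -/

/-- `P̃₁(λ) = -∑_{j=0}^{r-2} t_{2j+2} λ^j`. -/
def P1 {g : ℕ} (t : IrregularTimes g) (x : ℂ) : ℂ :=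
  -∑ j ∈ Finset.range (g + 2), irregTime t (2 * j + 2) * x ^ j

/-- `q̌_j = T₂ q_j + T₁`. -/
def shiftedQ {g : ℕ} (s : IrregularTimes g → ℂ) (q : Fin g → IrregularTimes g → ℂ) (j : Fin g)
    (t : IrregularTimes g) : ℂ :=
  timeT2 s t * q j t + timeT1 s t

/-- `p̌_j = T₂⁻¹ (p_j - P̃₁(q_j)/2)`. -/
def shiftedP {g : ℕ} (s : IrregularTimes g → ℂ)
    (L : IrregularTimes g → Matrix (Fin 2) (Fin 2) ℂ[X])
    (q : Fin g → IrregularTimes g → ℂ) (j : Fin g) (t : IrregularTimes g) : ℂ :=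
  (timeT2 s t)⁻¹ * (darbouxMomentum L q j t - P1 t (q j t) / 2)

/-! ### Trivial deformations -/

/-- The deformation operator `𝓛_α = ħ ∑_k α_k ∂_{t_k}`. -/
def deformation {g : ℕ} (ħ : ℂ) (α : IrregularTimes g) (f : IrregularTimes g → ℂ)
    (t : IrregularTimes g) : ℂ :=
  ħ * ∑ k, α k * pderivTime k f t

/-- `w_k = e_{2k}`, for `1 ≤ k ≤ r - 1`. -/
def vecW (g k : ℕ) : IrregularTimes g := fun i => if i.val + 1 = 2 * k then 1 else 0

/-- `u_k = (1/2) ∑_{m=1}^{2r-2k-4} m t_{m+2k+2} e_m` at the point `t`, for an integer `k ≥ -1`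
(the summation range is enforced by `irregTime`, which vanishes beyond `2r-2`). -/
def vecU {g : ℕ} (k : ℤ) (t : IrregularTimes g) : IrregularTimes g :=
  fun i => 1 / 2 * ((i.val : ℂ) + 1) * irregTime t ((i.val : ℤ) + 1 + 2 * k + 2).toNat

/-- `f` is annihilated on `U` by `𝓛_{w_1}, …, 𝓛_{w_{r-1}}`, `𝓛_{u_{-1}}` and `𝓛_{u_0}`. -/
def IsAnnihilated {g : ℕ} (ħ : ℂ) (U : Set (IrregularTimes g)) (f : IrregularTimes g → ℂ) : Prop :=
  ∀ t ∈ U, (∀ k ∈ Finset.Icc 1 (g + 2), deformation ħ (vecW g k) f t = 0) ∧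
    deformation ħ (vecU (-1) t) f t = 0 ∧ deformation ħ (vecU 0 t) f t = 0

/-! ### Dependence on the times -/

/-- On `U`, the derivatives of `f` with respect to all the trivial times vanish, in the coordinate
system formed by the trivial and the isomonodromic times: `df(v) = 0` for each coordinate vector
`v = ∂_{T_i}`. -/
def IsIndependentOfTrivialTimes {g : ℕ} (U : Set (IrregularTimes g)) (s : IrregularTimes g → ℂ)
    (f : IrregularTimes g → ℂ) : Prop :=
  DifferentiableOn ℂ f U ∧ ∀ t ∈ U, ∀ i : Fin (g + 2) ⊕ Fin 2, ∀ v : IrregularTimes g,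
    fderiv ℂ (allTimes s) t v = Pi.single (Sum.inl i) 1 → fderiv ℂ f t v = 0

/-- On all of `V`, `f` is a holomorphic function of the isomonodromic times alone. -/
def EqFunctionOfIsoTimes {g : ℕ} (V : Set (IrregularTimes g)) (s : IrregularTimes g → ℂ)
    (f : IrregularTimes g → ℂ) : Prop :=
  ∃ u : (Fin g → ℂ) → ℂ, DifferentiableOn ℂ u (isoTimes s '' V) ∧ ∀ t ∈ V, f t = u (isoTimes s t)

/-- `f` is a function of the isomonodromic times on `U`: near every point of `U`, and on the whole
of every open subset of `U` whose level sets of the isomonodromic times are connected (on an open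
set with disconnected level sets, a global function of these times cannot be expected). -/
def IsFunctionOfIsoTimes {g : ℕ} (U : Set (IrregularTimes g)) (s : IrregularTimes g → ℂ)
    (f : IrregularTimes g → ℂ) : Prop :=
  (∀ t₀ ∈ U, ∃ V, IsOpen V ∧ t₀ ∈ V ∧ V ⊆ U ∧ EqFunctionOfIsoTimes V s f) ∧
  ∀ V, IsOpen V → V ⊆ U → (∀ c, IsPreconnected {t ∈ V | isoTimes s t = c}) →
    EqFunctionOfIsoTimes V s f

/-- The domain of the principal branch: `t_{2r-3}` is not a non-positive real number. -/
def principalDomain (g : ℕ) : Set (IrregularTimes g) :=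
  {t | irregTime t (2 * g + 3) / 2 ∈ Complex.slitPlane}

/-- The principal branch of `(t_{2r-3}/2)^{1/(2r-3)}`. -/
def principalRoot {g : ℕ} (t : IrregularTimes g) : ℂ :=
  (irregTime t (2 * g + 3) / 2) ^ (1 / (2 * (g : ℂ) + 3))

end TwistedIsomonodromy

end

/-!
Everything is governed by the action of the affine group of the spectral parameter. The vector
fields `u₀` and `u₋₁` are, on the odd times `t_{2j+1}`, the infinitesimal translation and dilation
of `λ` acting on the formal function `∑ 2 t_{2j+1} / (2j+1) λ^(j+1/2)`, and the fields `w_k` move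
the even times freely, which only changes the connection by a scalar matrix. The change of
parameter `λ ↦ T₂ λ + T₁` normalizes the odd times to `t_{2g+3} = 2`, `t_{2g+1} = 0`, and the
isomonodromic times are half of the remaining odd times after this normalization (`isoTimeAux_eq`).

*Coordinates.* Undoing the normalization is a polynomial map `timesOf` in the even times, `T₁`,
`s = T₂^(1/2)` and the `τ_k`, and it inverts the new times (`timesOf_coordsOf`, `coordsOf_timesOf`);
as `s ≠ 0`, the trivial and isomonodromic times are local coordinates. The directions along which
all `τ_k` are constant are exactly those spanned by the `w_k`, `u₀` and `u₋₁`
(`IsRootBranch.fderiv_isoTimes_eq_zero_iff`). Hence being annihilated by the trivial deformations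
means being locally constant on the level sets of `τ`, which gives the local description of
annihilated functions and the one on open sets with connected level sets
(`isAnnihilated_iff_isFunctionOfIsoTimes`). On the domain of the principal branch, the path
`(r e, r T₁, exp (r log s))`, `0 ≤ r ≤ 1`, contracts the trivial times to `(0, 0, 1)` without
leaving the domain and without changing `τ`, so that `u c = f (timesOf ((0, 0, 1), c))` is a global
choice; it is entire because `timesOf` is polynomial.

*Connections.* The irregular type at infinity determines the trace of the connection, and the
coefficients of degree `≥ g` of its discriminant, in terms of the times
(`HasIrregularType.trace_discr`). Conversely a solution of the linearized Lax equation which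
preserves the normalization and these invariants vanishes (`eq_zero_of_lax`). So the derivative of
an isomonodromic family along a trivial direction can be guessed: it is the derivative coming from
the affine change of `λ`, followed by a diagonal gauge transformation which keeps `L₁₂` monic.
Therefore `T₂^g L₁₂` and `T₂^(-1) (L₁₁ - L₂₂)`, expressed in the shifted parameter `T₂ λ + T₁`, are
annihilated by the trivial deformations. The `q̌_j` are continuous roots of the first polynomial,
which is constant along the leaves, so they are constant there even where roots collide; `p̌_j` is
half of the value at `q̌_j` of the second one
(`IsIsomonodromicFamily.factorsLocally_shifted`).
-/

noncomputable section

namespace TwistedIsomonodromy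

open Polynomial Topology

/-! ### Orders of Laurent series -/

section

/-- All coefficients of `F` of index below `n` vanish, that is `F = O(w ^ n)`. -/
def VanishesBelow (n : ℤ) (F : LaurentSeries ℂ) : Prop := ∀ m < n, F.coeff m = 0

namespace VanishesBelow

variable {n m : ℤ} {F G : LaurentSeries ℂ}

lemma iff_le_orderTop : VanishesBelow n F ↔ (n : WithTop ℤ) ≤ F.orderTop := by
  rw [HahnSeries.le_orderTop_iff_forall]
  simp only [VanishesBelow, WithTop.coe_lt_coe]

lemma mono (h : VanishesBelow n F) (hm : m ≤ n) : VanishesBelow m F :=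
  fun k hk => h k (hk.trans_le hm)

lemma add (hF : VanishesBelow n F) (hG : VanishesBelow n G) : VanishesBelow n (F + G) :=
  fun k hk => by rw [HahnSeries.coeff_add, hF k hk, hG k hk, add_zero]

lemma sub (hF : VanishesBelow n F) (hG : VanishesBelow n G) : VanishesBelow n (F - G) :=
  fun k hk => by rw [HahnSeries.coeff_sub, hF k hk, hG k hk, sub_zero]

lemma neg (hF : VanishesBelow n F) : VanishesBelow n (-F) :=
  fun k hk => by rw [HahnSeries.coeff_neg, hF k hk, neg_zero]

lemma smul (c : ℂ) (hF : VanishesBelow n F) : VanishesBelow n (c • F) :=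
  fun k hk => by rw [HahnSeries.coeff_smul, hF k hk, smul_zero]

lemma mul (hF : VanishesBelow n F) (hG : VanishesBelow m G) : VanishesBelow (n + m) (F * G) := by
  rw [iff_le_orderTop] at *
  push_cast
  exact (add_le_add hF hG).trans HahnSeries.orderTop_add_le_mul

lemma single (n : ℤ) (c : ℂ) : VanishesBelow n (HahnSeries.single n c) :=
  fun _ hk => HahnSeries.coeff_single_of_ne hk.ne

lemma coeff_mul (hF : VanishesBelow n F) (hG : VanishesBelow m G) :
    (F * G).coeff (n + m) = F.coeff n * G.coeff m := by
  have hF' : VanishesBelow (n + 1) (F - HahnSeries.single n (F.coeff n)) := by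
    intro k hk
    rcases (Int.lt_add_one_iff.mp hk).lt_or_eq with h | rfl
    · rw [HahnSeries.coeff_sub, hF k h, HahnSeries.coeff_single_of_ne h.ne, sub_zero]
    · simp
  have h := hF'.mul hG (n + m) (by omega)
  rw [sub_mul, HahnSeries.coeff_sub, sub_eq_zero] at h
  rw [h, HahnSeries.coeff_single_mul, add_sub_cancel_left]

lemma succ (hF : VanishesBelow n F) (h : F.coeff n = 0) (hm : m = n + 1) : VanishesBelow m F := by
  intro k hk
  rcases (Int.lt_add_one_iff.mp (hm ▸ hk)).lt_or_eq with h' | rfl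
  exacts [hF k h', h]

lemma of_mul_right (h : VanishesBelow (n + m) (F * G)) (hG : VanishesBelow m G)
    (hG' : G.coeff m ≠ 0) : VanishesBelow n F := by
  rw [iff_le_orderTop] at *
  have hm : G.orderTop = m :=
    le_antisymm (HahnSeries.orderTop_le_of_coeff_ne_zero hG') hG
  rw [HahnSeries.orderTop_mul, hm] at h
  push_cast at h
  exact (WithTop.add_le_add_iff_right (WithTop.coe_ne_top)).mp h

end VanishesBelow

lemma laurentSeries_smul_eq (c : ℂ) (F : LaurentSeries ℂ) : c • F = HahnSeries.single 0 c * F :=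
  HahnSeries.single_zero_mul_eq_smul.symm

lemma coeff_derivLambda (F : LaurentSeries ℂ) (n : ℤ) :
    (derivLambda F).coeff n = -(1 / 2) * ((n : ℂ) - 2) * F.coeff (n - 2) := by
  rw [derivLambda, HahnSeries.coeff_single_mul, LaurentSeries.derivative_apply,
    LaurentSeries.hasseDeriv_coeff]
  have : n - 3 + ((1 : ℕ) : ℤ) = n - 2 := by push_cast; ring
  rw [this, Ring.choose_one_right, zsmul_eq_mul]
  push_cast
  ring

lemma derivLambda_sub (F G : LaurentSeries ℂ) :
    derivLambda (F - G) = derivLambda F - derivLambda G := by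
  simp [derivLambda, mul_sub]

lemma VanishesBelow.derivLambda {n m : ℤ} {F : LaurentSeries ℂ} (h : VanishesBelow n F)
    (hm : m = n + 2) : VanishesBelow m (derivLambda F) := fun k hk => by
  rw [coeff_derivLambda, h _ (by omega), mul_zero]

lemma derivLambda_mul (F G : LaurentSeries ℂ) :
    derivLambda (F * G) = derivLambda F * G + F * derivLambda G := by
  ext n
  -- the Euler operator `w ∂_w` multiplies the `k`-th coefficient by `k`
  have key : ∀ H : LaurentSeries ℂ, ∃ E : LaurentSeries ℂ,
      derivLambda H = HahnSeries.single 2 (-(1 / 2)) * E ∧ ∀ k, E.coeff k = k * H.coeff k := by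
    intro H
    refine ⟨HahnSeries.single (-2) (-2) * derivLambda H, ?_, fun k => ?_⟩
    · rw [← mul_assoc, HahnSeries.single_mul_single]
      norm_num
    · rw [HahnSeries.coeff_single_mul, coeff_derivLambda]
      have : k - -2 - 2 = k := by ring
      rw [this]
      push_cast
      ring
  obtain ⟨E, hE, hEc⟩ := key F
  obtain ⟨E', hE', hEc'⟩ := key G
  obtain ⟨E'', hE'', hEc''⟩ := key (F * G)
  have hs : E.support ⊆ F.support := fun k hk hF => hk (by
    rw [hEc]
    change F.coeff k = 0 at hF
    rw [hF, mul_zero])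
  have hs' : E'.support ⊆ G.support := fun k hk hF => hk (by
    rw [hEc']
    change G.coeff k = 0 at hF
    rw [hF, mul_zero])
  have hsum : E'' = E * G + F * E' := by
    ext k
    rw [hEc'', HahnSeries.coeff_add, HahnSeries.coeff_mul_left' F.isPWO_support hs,
      HahnSeries.coeff_mul_right' G.isPWO_support hs', HahnSeries.coeff_mul, Finset.mul_sum,
      ← Finset.sum_add_distrib]
    refine Finset.sum_congr rfl fun ij hij => ?_
    rw [Finset.mem_antidiagonal] at hij
    rw [hEc, hEc', ← hij.2.2]
    push_cast
    ring
  rw [hE'', hE, hE', hsum]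
  ring_nf

/-- Polynomials in `λ = w⁻²`, as Laurent series in `w`. -/
abbrev polyToLaurent : ℂ[X] →ₐ[ℂ] LaurentSeries ℂ :=
  Polynomial.aeval (HahnSeries.single (-2 : ℤ) (1 : ℂ))

lemma polyToLaurent_monomial (n : ℕ) (a : ℂ) :
    polyToLaurent (monomial n a) = HahnSeries.single (-2 * (n : ℤ)) a := by
  rw [polyToLaurent, aeval_monomial, HahnSeries.single_pow]
  have : algebraMap ℂ (LaurentSeries ℂ) a = HahnSeries.C a := by
    simp [HahnSeries.algebraMap_apply']
  rw [this]
  simp [mul_comm]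

lemma coeff_polyToLaurent (P : ℂ[X]) (n : ℕ) :
    (polyToLaurent P).coeff (-2 * (n : ℤ)) = P.coeff n := by
  induction P using Polynomial.induction_on' with
  | add p q hp hq => rw [map_add, HahnSeries.coeff_add, hp, hq, coeff_add]
  | monomial k a =>
    rw [polyToLaurent_monomial, coeff_monomial, HahnSeries.coeff_single]
    congr 1
    simp only [eq_iff_iff]
    omega

lemma coeff_polyToLaurent_eq_zero (P : ℂ[X]) (m : ℤ) (hm : ∀ n : ℕ, m ≠ -2 * n) :
    (polyToLaurent P).coeff m = 0 := by
  induction P using Polynomial.induction_on' with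
  | add p q hp hq => rw [map_add, HahnSeries.coeff_add, hp, hq, add_zero]
  | monomial k a =>
    rw [polyToLaurent_monomial, HahnSeries.coeff_single_of_ne (hm k)]

lemma vanishesBelow_polyToLaurent {P : ℂ[X]} {N : ℕ} {m : ℤ} (h : ∀ n, N ≤ n → P.coeff n = 0)
    (hm : m ≤ 2 - 2 * (N : ℤ)) : VanishesBelow m (polyToLaurent P) := by
  intro k hk
  by_cases hn : ∃ n : ℕ, k = -2 * n
  · obtain ⟨n, rfl⟩ := hn
    rw [coeff_polyToLaurent, h n (by omega)]
  · exact coeff_polyToLaurent_eq_zero P k (by simpa using hn)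

end

/-! ### What the irregular type says about the trace and the discriminant -/

section

/-- `∑_{j ≤ g+1} t_{2j+1} λ ^ j`, the generating polynomial of the odd irregular times. -/
def oddPoly {g : ℕ} (t : IrregularTimes g) : ℂ[X] :=
  ∑ j ∈ Finset.range (g + 2), monomial j (irregTime t (2 * j + 1))

/-- The discriminant `(tr L)² - 4 det L` of a `2 × 2` matrix. -/
def discr (L : Matrix (Fin 2) (Fin 2) ℂ[X]) : ℂ[X] :=
  (L 0 0 - L 1 1) ^ 2 + 4 * (L 0 1 * L 1 0)

lemma irregTime_of_lt {g : ℕ} (t : IrregularTimes g) {k : ℕ} (hk : 2 * g + 4 < k) :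
    irregTime t k = 0 := dif_neg (by omega)

lemma irregTime_zero {g : ℕ} (t : IrregularTimes g) : irregTime t 0 = 0 := dif_neg (by omega)

lemma coeff_oddPoly {g : ℕ} (t : IrregularTimes g) (j : ℕ) :
    (oddPoly t).coeff j = irregTime t (2 * j + 1) := by
  rw [oddPoly, finsetSum_coeff]
  simp only [coeff_monomial]
  rw [Finset.sum_ite_eq' (Finset.range (g + 2)) j]
  split_ifs with h
  · rfl
  · rw [irregTime_of_lt]
    simp only [Finset.mem_range] at h
    omega

lemma coeff_irregularPart {g : ℕ} (ħ : ℂ) (t : IrregularTimes g) (ε : ℂ) (n : ℤ) :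
    (irregularPart ħ t ε).coeff n = -(1 / 2) * ε ^ (2 - n).toNat * irregTime t (2 - n).toNat +
      if n = 2 then ħ / 4 else 0 := by
  rw [irregularPart, HahnSeries.coeff_add, HahnSeries.coeff_single, HahnSeries.coeff_sum]
  congr 1
  swap
  · congr
  simp only [HahnSeries.coeff_single]
  by_cases h : 1 ≤ (2 - n).toNat ∧ (2 - n).toNat ≤ 2 * g + 4
  · rw [Finset.sum_eq_single (2 - n).toNat]
    · rw [if_pos (by omega)]
    · intro b _ hb
      rw [if_neg (by omega)]
    · intro hn
      exact absurd (Finset.mem_Icc.mpr h) hn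
  · rw [Finset.sum_eq_zero]
    · rw [irregTime, dif_neg h, mul_zero]
    · intro k hk
      rw [Finset.mem_Icc] at hk
      rw [if_neg (by omega)]

/-- The part of the irregular type that is odd under the exchange of the two sheets. -/
lemma irregularPart_sub {g : ℕ} (ħ : ℂ) (t : IrregularTimes g) :
    irregularPart ħ t 1 - irregularPart ħ t (-1) =
      -(HahnSeries.single 1 1 * polyToLaurent (oddPoly t)) := by
  ext n
  rw [HahnSeries.coeff_sub, HahnSeries.coeff_neg, HahnSeries.coeff_single_mul,
    coeff_irregularPart, coeff_irregularPart, one_pow, one_mul]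
  by_cases h : ∃ j : ℕ, n - 1 = -2 * j
  · obtain ⟨j, hj⟩ := h
    rw [hj, coeff_polyToLaurent, coeff_oddPoly, show (2 - n).toNat = 2 * j + 1 by omega,
      pow_succ, pow_mul]
    norm_num
    ring
  · rw [coeff_polyToLaurent_eq_zero _ _ (by simpa using h)]
    by_cases h0 : (2 - n).toNat = 0
    · rw [h0, irregTime_zero]
      ring
    · obtain ⟨k, hk⟩ : ∃ k, (2 - n).toNat = 2 * k := by
        rcases Nat.even_or_odd' (2 - n).toNat with ⟨k, hk | hk⟩
        · exact ⟨k, hk⟩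
        · exact absurd ⟨k, by omega⟩ h
      rw [hk, pow_mul]
      norm_num

lemma coeff_irregularPart_add {g : ℕ} (ħ : ℂ) (t : IrregularTimes g) (n : ℕ) :
    (irregularPart ħ t 1 + irregularPart ħ t (-1)).coeff (-2 * (n : ℤ)) =
      -irregTime t (2 * n + 2) := by
  rw [HahnSeries.coeff_add, coeff_irregularPart, coeff_irregularPart,
    show (2 - -2 * (n : ℤ)).toNat = 2 * (n + 1) by omega, pow_mul, if_neg (by omega)]
  norm_num
  ring_nf

/-- One row of the gauge equation: `(x, y)` is a row of the gauge transformation, `Q` the odd part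
of the irregular type, and `[a, b; c, -a]` the traceless part of the connection. If `y` is a unit of
`ℂ⟦w⟧`, elimination of `x` gives `a² + b c = Q²` up to the order `w ^ (2 - 2 g)`: the two
corrections in `ħ`, one from `∂_λ x` and one from the term `ħ / (4 z²)`, cancel. -/
lemma vanishesBelow_of_gauge_row {g : ℕ} {ħ : ℂ} {a b c Q x y e₁ e₂ : LaurentSeries ℂ}
    (ha : VanishesBelow (2 - 2 * (g : ℤ)) a) (hb : VanishesBelow (-2 * (g : ℤ)) b)
    (hb1 : b.coeff (-2 * (g : ℤ)) = 1)
    (hQ : VanishesBelow (-2 * (g : ℤ) - 1) Q)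
    (hx : VanishesBelow (-1) x) (hy : VanishesBelow 0 y) (hy0 : y.coeff 0 ≠ 0)
    (he₁ : VanishesBelow 2 e₁) (he₂ : VanishesBelow 3 e₂)
    (h₁ : x * a + y * c + ħ • derivLambda x = (Q + HahnSeries.single 2 (ħ / 4)) * x + e₁)
    (h₂ : x * b - y * a + ħ • derivLambda y = (Q + HahnSeries.single 2 (ħ / 4)) * y + e₂) :
    VanishesBelow (2 - 2 * (g : ℤ)) (a ^ 2 + b * c - Q ^ 2) := by
  set h : LaurentSeries ℂ := HahnSeries.single 2 (ħ / 4) with hh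
  have hh2 : VanishesBelow 2 h := VanishesBelow.single _ _
  have hdy : VanishesBelow 3 (derivLambda y) :=
    (hy.derivLambda (m := 2) (by ring)).succ (by rw [coeff_derivLambda]; norm_num) (by ring)
  have hdx : VanishesBelow 1 (derivLambda x) := hx.derivLambda (by ring)
  have hdx1 : (derivLambda x).coeff 1 = 1 / 2 * x.coeff (-1) := by
    rw [coeff_derivLambda]
    norm_num
  set e₃ := e₂ - ħ • derivLambda y with he₃def
  have he₃ : VanishesBelow 3 e₃ := he₂.sub (hdy.smul ħ)
  have hbx : b * x = (Q + a + h) * y + e₃ := by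
    rw [he₃def]
    linear_combination h₂
  have hQy := hQ.mul hy
  have hxQ : x.coeff (-1) = Q.coeff (-2 * (g : ℤ) - 1) * y.coeff 0 := by
    have h3 := congrArg (fun F => F.coeff (-2 * (g : ℤ) + -1)) hbx
    simp only [HahnSeries.coeff_add, add_mul] at h3
    rw [hb.coeff_mul hx, hb1, one_mul, (ha.mul hy) _ (by omega), (hh2.mul hy) _ (by omega),
      he₃ _ (by omega)] at h3
    have h4 := hQ.coeff_mul hy
    rw [show -2 * (g : ℤ) - 1 + 0 = -2 * (g : ℤ) + -1 by ring] at h4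
    rw [h3, h4]
    ring
  have hmain : (a ^ 2 + b * c - Q ^ 2) * y =
      h * (Q * y) + h * (Q * y) - ħ • (b * derivLambda x) + b * e₁ + (Q + h - a) * e₃ +
        h * h * y := by
    rw [laurentSeries_smul_eq] at h₁ ⊢
    linear_combination b * h₁ + (Q + h - a) * hbx
  have hlead : VanishesBelow (2 - 2 * (g : ℤ))
      (h * (Q * y) + h * (Q * y) - ħ • (b * derivLambda x)) := by
    have e1 : VanishesBelow (-2 * (g : ℤ) + 1) (h * (Q * y) + h * (Q * y)) :=
      ((hh2.mul hQy).add (hh2.mul hQy)).mono (by omega)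
    have e2 : VanishesBelow (-2 * (g : ℤ) + 1) (ħ • (b * derivLambda x)) := (hb.mul hdx).smul ħ
    refine (e1.sub e2).succ ?_ (by ring)
    have h4 := hh2.coeff_mul hQy
    rw [show 2 + (-2 * (g : ℤ) - 1 + 0) = -2 * (g : ℤ) + 1 by ring, hQ.coeff_mul hy] at h4
    rw [HahnSeries.coeff_sub, HahnSeries.coeff_add, HahnSeries.coeff_smul, h4,
      hb.coeff_mul hdx, hb1, hdx1, hxQ, hh, HahnSeries.coeff_single_same, smul_eq_mul]
    ring
  refine VanishesBelow.of_mul_right (m := 0) (G := y) ?_ hy hy0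
  rw [hmain, add_zero]
  have hQha : VanishesBelow (-2 * (g : ℤ) - 1) (Q + h - a) :=
    (hQ.add (hh2.mono (by omega))).sub (ha.mono (by omega))
  exact ((hlead.add ((hb.mul he₁).mono (by omega))).add ((hQha.mul he₃).mono (by omega))).add
    (((hh2.mul hh2).mul hy).mono (by omega))

variable {g : ℕ} {ħ : ℂ} {t : IrregularTimes g} {L : Matrix (Fin 2) (Fin 2) ℂ[X]}

lemma IsNormalizedAtInfinity.coeff_eq_zero (hL : IsNormalizedAtInfinity t L) (a b : Fin 2) {n : ℕ}
    (hn : g + 2 ≤ n) : (L a b).coeff n = 0 :=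
  coeff_eq_zero_of_natDegree_lt ((hL.natDegree_le a b).trans_lt (by omega))

lemma IsNormalizedAtInfinity.coeff_sub (hL : IsNormalizedAtInfinity t L) {n : ℕ} (hn : g ≤ n) :
    (L 0 0 - L 1 1).coeff n = 0 := by
  rw [Polynomial.coeff_sub, sub_eq_zero]
  obtain ⟨δ, h2⟩ := hL.subleading
  have h1 := hL.leading
  rcases hn.lt_or_eq with h | rfl
  · rcases (Nat.succ_le_of_lt h).lt_or_eq with h | rfl
    · rw [hL.coeff_eq_zero _ _ h, hL.coeff_eq_zero _ _ h]
    · have a := congrFun (congrFun h1 0) 0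
      have b := congrFun (congrFun h1 1) 1
      simp at a b
      rw [a, b]
  · have a := congrFun (congrFun h2 0) 0
    have b := congrFun (congrFun h2 1) 1
    simp at a b
    rw [a, b]

lemma IsNormalizedAtInfinity.coeff_zero_one (hL : IsNormalizedAtInfinity t L) {n : ℕ}
    (hn : g + 1 ≤ n) : (L 0 1).coeff n = 0 := by
  rcases hn.lt_or_eq with h | rfl
  · exact hL.coeff_eq_zero _ _ h
  · simpa using congrFun (congrFun hL.leading 0) 1

lemma IsNormalizedAtInfinity.coeff_zero_one_top (hL : IsNormalizedAtInfinity t L) :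
    (L 0 1).coeff g = 1 := by
  obtain ⟨δ, h2⟩ := hL.subleading
  simpa using congrFun (congrFun h2 0) 1

lemma IsNormalizedAtInfinity.coeff_one_zero_top (hL : IsNormalizedAtInfinity t L) :
    (L 1 0).coeff (g + 1) = irregTime t (2 * g + 3) ^ 2 / 4 := by
  simpa using congrFun (congrFun hL.leading 1) 0

/-- The irregular type determines the trace of the connection and the coefficients of its
discriminant of degree `≥ g`. -/
lemma HasIrregularType.trace_discr (hħ : ħ ≠ 0) (ht : irregTime t (2 * g + 3) ≠ 0)
    (hL : IsNormalizedAtInfinity t L) (h : HasIrregularType ħ t L) :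
    (∀ n, (L 0 0 + L 1 1).coeff n = -irregTime t (2 * n + 2)) ∧
      ∀ n, g ≤ n → (discr L).coeff n = (oddPoly t ^ 2).coeff (n + 1) := by
  obtain ⟨G, K, hG, -, hdet, heq, hK⟩ := h
  have hK' : ∀ a b, VanishesBelow 3
      (K a b - Matrix.diagonal ![irregularPart ħ t 1, irregularPart ħ t (-1)] a b) :=
    fun a b n hn => by simpa using hK a b n hn
  have k00 := hK' 0 0
  have k01 := hK' 0 1
  have k10 := hK' 1 0
  have k11 := hK' 1 1
  simp only [Matrix.diagonal_apply, Matrix.cons_val_zero, Matrix.cons_val_one, if_true,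
    Fin.isValue, zero_ne_one, one_ne_zero, if_false, sub_zero] at k00 k01 k10 k11
  have q00 := congrFun (congrFun heq 0) 0
  have q01 := congrFun (congrFun heq 0) 1
  have q10 := congrFun (congrFun heq 1) 0
  have q11 := congrFun (congrFun heq 1) 1
  simp only [Matrix.add_apply, Matrix.mul_apply, Fin.sum_univ_two, Matrix.smul_apply,
    Matrix.map_apply, toLaurent] at q00 q01 q10 q11
  have hG' : ∀ a b, VanishesBelow (-1) (G a b) := fun a b n hn => hG a b n hn
  rw [Matrix.det_fin_two] at hdet
  set x := G 0 0
  set y := G 0 1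
  set u := G 1 0
  set v := G 1 1
  set d := x * v - y * u with hd
  have hdd : derivLambda d = derivLambda x * v + x * derivLambda v -
      (derivLambda y * u + y * derivLambda u) := by
    rw [hd, derivLambda_sub, derivLambda_mul, derivLambda_mul]
  set ν := d.order with hν
  have hdν : VanishesBelow ν d := fun k hk => HahnSeries.coeff_eq_zero_of_lt_order hk
  have hdν0 : d.coeff ν ≠ 0 := by
    exact fun h0 => hdet (HahnSeries.coeff_order_eq_zero.mp h0)
  have hd' : VanishesBelow (ν + 2) (derivLambda d) := hdν.derivLambda rfl
  set E₀ := polyToLaurent (L 0 0 + L 1 1) with hE₀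
  have hE₀' : polyToLaurent (L 0 0) + polyToLaurent (L 1 1) = E₀ := by rw [hE₀, map_add]
  -- the trace of the gauge equation
  have hT : (E₀ - (K 0 0 + K 1 1)) * d = -(ħ • derivLambda d) := by
    rw [← hE₀']
    rw [laurentSeries_smul_eq] at q00 q01 q10 q11 ⊢
    rw [hdd, hd]
    linear_combination v * q00 - u * q01 - y * q10 + x * q11
  have hT2 : VanishesBelow 2 (E₀ - (K 0 0 + K 1 1)) := by
    refine VanishesBelow.of_mul_right (m := ν) ?_ hdν hdν0
    rw [hT, add_comm]
    exact (hd'.smul ħ).neg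
  have hT2' : (E₀ - (K 0 0 + K 1 1)).coeff 2 = 1 / 2 * ħ * ν := by
    have h1 := hT2.coeff_mul hdν
    rw [hT, HahnSeries.coeff_neg, HahnSeries.coeff_smul, coeff_derivLambda, smul_eq_mul,
      show 2 + ν - 2 = ν by ring] at h1
    refine mul_right_cancel₀ hdν0 ?_
    rw [← h1]
    push_cast
    ring
  have hK2 : ∀ n < 3, (K 0 0 + K 1 1).coeff n =
      (irregularPart ħ t 1 + irregularPart ħ t (-1)).coeff n := by
    intro n hn
    have h1 := k00 n hn
    have h2 := k11 n hn
    rw [HahnSeries.coeff_sub, sub_eq_zero] at h1 h2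
    rw [HahnSeries.coeff_add, HahnSeries.coeff_add, h1, h2]
  have htrace : ∀ n, (L 0 0 + L 1 1).coeff n = -irregTime t (2 * n + 2) := by
    intro n
    have h1 := hT2 (-2 * n) (by omega)
    rw [HahnSeries.coeff_sub, hK2 _ (by omega), hE₀, coeff_polyToLaurent,
      coeff_irregularPart_add, sub_eq_zero] at h1
    exact h1
  refine ⟨htrace, ?_⟩
  have hip2 : (irregularPart ħ t 1 + irregularPart ħ t (-1)).coeff 2 = ħ / 2 := by
    rw [HahnSeries.coeff_add, coeff_irregularPart, coeff_irregularPart]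
    norm_num [irregTime_zero]
    ring
  have hE₀2 : E₀.coeff 2 = 0 := coeff_polyToLaurent_eq_zero _ _ (by intro n; omega)
  have hν1 : ν = -1 := by
    rw [HahnSeries.coeff_sub, hK2 2 (by norm_num), hip2, hE₀2] at hT2'
    have : (ν : ℂ) = -1 := by
      refine mul_left_cancel₀ hħ ?_
      linear_combination -2 * hT2'
    exact_mod_cast this
  -- the symmetric part of the irregular type is half of the trace, up to `ħ / (4 z²)`
  set P := irregularPart ħ t 1 with hP
  set P' := irregularPart ħ t (-1) with hP'
  have hS : VanishesBelow 3 (P + P' - E₀ - HahnSeries.single 2 (ħ / 2)) := by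
    intro n hn
    rw [HahnSeries.coeff_sub, HahnSeries.coeff_sub]
    rcases (show n ≤ 2 by omega).lt_or_eq with h | rfl
    · have h1 := hT2 n h
      rw [HahnSeries.coeff_sub, hK2 n hn, sub_eq_zero] at h1
      rw [HahnSeries.coeff_single_of_ne h.ne, h1, sub_self, sub_zero]
    · rw [hip2, hE₀2, HahnSeries.coeff_single_same]
      ring
  set κ : LaurentSeries ℂ := HahnSeries.single 0 (1 / 2) with hκ
  have hκ2 : 2 * κ = 1 := by
    rw [hκ, two_mul, ← HahnSeries.C_apply, ← map_add]
    norm_num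
  have hκh : HahnSeries.single 2 (ħ / 4) = κ * HahnSeries.single 2 (ħ / 2) := by
    rw [hκ, HahnSeries.single_mul_single]
    congr 1
    ring
  set a := κ * polyToLaurent (L 0 0 - L 1 1) with ha
  set b := polyToLaurent (L 0 1) with hb
  set c := polyToLaurent (L 1 0) with hc
  set Q := κ * (P - P') with hQ
  have hκ0 : VanishesBelow 0 κ := VanishesBelow.single _ _
  have haV : VanishesBelow (2 - 2 * (g : ℤ)) a := by
    have := hκ0.mul (vanishesBelow_polyToLaurent (fun n hn => hL.coeff_sub hn) le_rfl)
    rwa [zero_add] at this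
  have hbV : VanishesBelow (-2 * (g : ℤ)) b :=
    vanishesBelow_polyToLaurent (fun n hn => hL.coeff_zero_one hn) (by push_cast; omega)
  have hb1 : b.coeff (-2 * (g : ℤ)) = 1 := by
    rw [hb, coeff_polyToLaurent, hL.coeff_zero_one_top]
  have hQ' : Q = -(κ * (HahnSeries.single 1 1 * polyToLaurent (oddPoly t))) := by
    rw [hQ, hP, hP', irregularPart_sub]
    ring
  have hoV : VanishesBelow (-2 * (g : ℤ) - 2) (polyToLaurent (oddPoly t)) :=
    vanishesBelow_polyToLaurent (N := g + 2)
      (fun n hn => by rw [coeff_oddPoly, irregTime_of_lt t (by omega)]) (by push_cast; omega)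
  have hQV : VanishesBelow (-2 * (g : ℤ) - 1) Q := by
    rw [hQ']
    exact ((hκ0.mul ((VanishesBelow.single 1 1).mul hoV)).neg).mono (by omega)
  have hQ1 : Q.coeff (-2 * (g : ℤ) - 1) ≠ 0 := by
    rw [hQ', HahnSeries.coeff_neg, hκ, HahnSeries.coeff_single_zero_mul,
      HahnSeries.coeff_single_mul,
      show -2 * (g : ℤ) - 1 - 1 = -2 * ((g + 1 : ℕ) : ℤ) by push_cast; ring, coeff_polyToLaurent,
      coeff_oddPoly]
    simpa [mul_add, add_assoc] using ht
  have hh2 : VanishesBelow 2 (HahnSeries.single (2 : ℤ) (ħ / 4)) := VanishesBelow.single _ _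
  have hL00 : polyToLaurent (L 0 0) = κ * E₀ + a := by
    rw [ha, ← hE₀', map_sub]
    linear_combination -polyToLaurent (L 0 0) * hκ2
  have hL11 : polyToLaurent (L 1 1) = κ * E₀ - a := by
    rw [ha, ← hE₀', map_sub]
    linear_combination -polyToLaurent (L 1 1) * hκ2
  -- the error terms of the two rows
  have f0 : VanishesBelow 3 (K 0 0 - κ * E₀ - HahnSeries.single 2 (ħ / 4) - Q) := by
    have : K 0 0 - κ * E₀ - HahnSeries.single 2 (ħ / 4) - Q =
        (K 0 0 - P) + κ * (P + P' - E₀ - HahnSeries.single 2 (ħ / 2)) := by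
      rw [hQ, hκh]
      linear_combination -P * hκ2
    rw [this]
    exact k00.add ((hκ0.mul hS).mono (by norm_num))
  have f1 : VanishesBelow 3 (K 1 1 - κ * E₀ - HahnSeries.single 2 (ħ / 4) + Q) := by
    have : K 1 1 - κ * E₀ - HahnSeries.single 2 (ħ / 4) + Q =
        (K 1 1 - P') + κ * (P + P' - E₀ - HahnSeries.single 2 (ħ / 2)) := by
      rw [hQ, hκh]
      linear_combination -P' * hκ2
    rw [this]
    exact k11.add ((hκ0.mul hS).mono (by norm_num))
  set h := HahnSeries.single (2 : ℤ) (ħ / 4) with hh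
  set f₀ := K 0 0 - κ * E₀ - h - Q with hf₀
  set f₁ := K 1 1 - κ * E₀ - h + Q with hf₁
  have r1 : x * a + y * c + ħ • derivLambda x = (Q + h) * x + (f₀ * x + K 0 1 * u) := by
    linear_combination q00 - x * hL00 + x * hf₀
  have r2 : x * b - y * a + ħ • derivLambda y = (Q + h) * y + (f₀ * y + K 0 1 * v) := by
    linear_combination q01 - y * hL11 + y * hf₀
  have r3 : u * a + v * c + ħ • derivLambda u = (-Q + h) * u + (f₁ * u + K 1 0 * x) := by
    linear_combination q10 - u * hL00 + u * hf₁
  have r4 : u * b - v * a + ħ • derivLambda v = (-Q + h) * v + (f₁ * v + K 1 0 * y) := by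
    linear_combination q11 - v * hL11 + v * hf₁
  have hxV : VanishesBelow (-1) x := hG' 0 0
  have hyV : VanishesBelow (-1) y := hG' 0 1
  have huV : VanishesBelow (-1) u := hG' 1 0
  have hvV : VanishesBelow (-1) v := hG' 1 1
  -- the second column of the gauge transformation has no pole
  have key : ∀ {q ξ η e : LaurentSeries ℂ}, VanishesBelow (-2 * (g : ℤ) - 1) q →
      q.coeff (-2 * (g : ℤ) - 1) ≠ 0 → VanishesBelow (-1) ξ → VanishesBelow (-1) η →
      VanishesBelow 2 e → ξ * b - η * a + ħ • derivLambda η = (q + h) * η + e →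
      VanishesBelow 0 η := by
    intro q ξ η e hq hq1 hξ hη he hr
    refine hη.succ ?_ (by ring)
    have h1 : q * η = b * ξ - a * η + ħ • derivLambda η - h * η - e := by
      linear_combination -hr
    have h2 := hq.coeff_mul hη
    have hdη : VanishesBelow 1 (derivLambda η) := hη.derivLambda (by ring)
    rw [h1, HahnSeries.coeff_sub, HahnSeries.coeff_sub, HahnSeries.coeff_add,
      HahnSeries.coeff_sub, (hbV.mul hξ) _ (by omega), (haV.mul hη) _ (by omega),
      (hdη.smul ħ) _ (by omega), (hh2.mul hη) _ (by omega), he _ (by omega)] at h2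
    have h3 : q.coeff (-2 * (g : ℤ) - 1) * η.coeff (-1) = 0 := by
      rw [← h2]
      ring
    exact (mul_eq_zero.mp h3).resolve_left hq1
  have hy0 := key hQV hQ1 hxV hyV
    (((f0.mul hyV).mono (by norm_num)).add ((k01.mul hvV).mono (by norm_num))) r2
  have hv0 := key hQV.neg (by rw [HahnSeries.coeff_neg]; exact neg_ne_zero.mpr hQ1) huV hvV
    (((f1.mul hvV).mono (by norm_num)).add ((k10.mul hyV).mono (by norm_num))) r4
  have hmain : VanishesBelow (2 - 2 * (g : ℤ)) (a ^ 2 + b * c - Q ^ 2) := by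
    by_cases hy : y.coeff 0 = 0
    · have hv : v.coeff 0 ≠ 0 := by
        intro hv
        apply hdν0
        have h1 := hxV.coeff_mul hv0
        have h2 := hy0.coeff_mul huV
        rw [hv, mul_zero] at h1
        rw [hy, zero_mul] at h2
        norm_num at h1 h2
        rw [hν1, hd, HahnSeries.coeff_sub, h1, h2, sub_zero]
      have hsq : Q ^ 2 = (-Q) ^ 2 := by ring
      rw [hsq]
      exact vanishesBelow_of_gauge_row haV hbV hb1 hQV.neg huV hv0 hv
        (((f1.mul huV).mono (by norm_num)).add ((k10.mul hxV).mono (by norm_num)))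
        (((f1.mul hv0).mono (by norm_num)).add ((k10.mul hy0).mono (by norm_num))) r3 r4
    · exact vanishesBelow_of_gauge_row haV hbV hb1 hQV hxV hy0 hy
        (((f0.mul hxV).mono (by norm_num)).add ((k01.mul huV).mono (by norm_num)))
        (((f0.mul hy0).mono (by norm_num)).add ((k01.mul hv0).mono (by norm_num))) r1 r2
  intro n hn
  have hid : polyToLaurent (discr L) - HahnSeries.single 2 1 * polyToLaurent (oddPoly t ^ 2) =
      4 * (a ^ 2 + b * c - Q ^ 2) := by
    have hs : (HahnSeries.single (2 : ℤ) (1 : ℂ)) =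
        HahnSeries.single 1 1 * HahnSeries.single 1 1 := by
      rw [HahnSeries.single_mul_single]
      norm_num
    rw [hs, discr, hQ', ha, map_add, map_pow, map_mul, map_mul, map_ofNat, map_pow]
    linear_combination (-(1 + 2 * κ) * (polyToLaurent (L 0 0 - L 1 1) ^ 2 -
      (HahnSeries.single 1 1 * polyToLaurent (oddPoly t)) ^ 2)) * hκ2
  have h4 : VanishesBelow (2 - 2 * (g : ℤ)) (4 * (a ^ 2 + b * c - Q ^ 2)) := by
    rw [show (4 : LaurentSeries ℂ) = 1 + 1 + 1 + 1 by norm_num]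
    simp only [add_mul, one_mul]
    exact ((hmain.add hmain).add hmain).add hmain
  rw [← hid] at h4
  have h5 := h4 (-2 * n) (by omega)
  rw [HahnSeries.coeff_sub, coeff_polyToLaurent, HahnSeries.coeff_single_mul, one_mul,
    show -2 * (n : ℤ) - 2 = -2 * ((n + 1 : ℕ) : ℤ) by push_cast; ring, coeff_polyToLaurent,
    sub_eq_zero] at h5
  exact h5

end

/-! ### Rigidity of the Lax equation -/

section

section Coefficients

variable {p q : ℂ[X]} {m n : ℕ}

lemma coeff_mul_add (hp : ∀ k, m < k → p.coeff k = 0) (hq : ∀ k, n < k → q.coeff k = 0) :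
    (p * q).coeff (m + n) = p.coeff m * q.coeff n :=
  coeff_mul_add_eq_of_natDegree_le (natDegree_le_iff_coeff_eq_zero.mpr hp)
    (natDegree_le_iff_coeff_eq_zero.mpr hq)

lemma coeff_mul_eq_zero_of_le (hp : ∀ k, m ≤ k → p.coeff k = 0) (hq : ∀ k, n < k → q.coeff k = 0)
    {k : ℕ} (hk : m + n ≤ k) : (p * q).coeff k = 0 := by
  rw [coeff_mul]
  refine Finset.sum_eq_zero fun ij hij => ?_
  rw [Finset.HasAntidiagonal.mem_antidiagonal] at hij
  by_cases h : m ≤ ij.1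
  · rw [hp _ h, zero_mul]
  · rw [hq _ (by omega), mul_zero]

lemma coeff_eq_zero_of_mul (hq : ∀ k, n < k → q.coeff k = 0) (hq1 : q.coeff n ≠ 0)
    (h : ∀ k, m + n ≤ k → (p * q).coeff k = 0) {k : ℕ} (hk : m ≤ k) : p.coeff k = 0 := by
  by_contra hpk
  have hN := le_natDegree_of_ne_zero hpk
  have h1 := h (p.natDegree + n) (by omega)
  rw [coeff_mul_add (fun k hk => coeff_eq_zero_of_natDegree_lt hk) hq] at h1
  rcases mul_eq_zero.mp h1 with h1 | h1
  · rw [coeff_natDegree, leadingCoeff_eq_zero] at h1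
    exact hpk (by rw [h1, coeff_zero])
  · exact hq1 h1

end Coefficients

/-- Rigidity: a tangent vector `M` which comes from a polynomial gauge transformation `B` and which
preserves the normalization at infinity, the trace and the coefficients of degree `≥ g` of the
discriminant, vanishes. If the entry `B₁₂` had degree `n ≥ 0` and leading coefficient `β`, the
coefficient of degree `g + n` in the variation of the discriminant would be a nonzero multiple of
`(2 n + 1) β`. -/
lemma eq_zero_of_lax {ħ : ℂ} (hħ : ħ ≠ 0) {g : ℕ} {L M B : Matrix (Fin 2) (Fin 2) ℂ[X]}
    (ha : ∀ n, g ≤ n → (L 0 0 - L 1 1).coeff n = 0)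
    (hb : ∀ n, g < n → (L 0 1).coeff n = 0) (hb1 : (L 0 1).coeff g = 1)
    (hc : ∀ n, g + 1 < n → (L 1 0).coeff n = 0) (hc1 : (L 1 0).coeff (g + 1) ≠ 0)
    (hlax : ∀ a b, C ħ * M a b = (B * L - L * B) a b + C ħ * derivative (B a b))
    (htr : M 0 0 + M 1 1 = 0) (hM0 : ∀ n, g ≤ n → (M 0 0).coeff n = 0)
    (hM1 : ∀ n, g ≤ n → (M 0 1).coeff n = 0)
    (hdiscr : ∀ n, g ≤ n →
      ((L 0 0 - L 1 1) * (M 0 0 - M 1 1) + 2 * (M 0 1 * L 1 0 + L 0 1 * M 1 0)).coeff n = 0) :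
    M = 0 := by
  have hC : (C ħ : ℂ[X]) ≠ 0 := C_ne_zero.mpr hħ
  have l00 := hlax 0 0
  have l01 := hlax 0 1
  have l10 := hlax 1 0
  have l11 := hlax 1 1
  simp only [Matrix.sub_apply, Matrix.mul_apply, Fin.sum_univ_two] at l00 l01 l10 l11
  set a := L 0 0 - L 1 1 with ha'
  set b := L 0 1
  set c := L 1 0
  set α := B 0 0 - B 1 1 with hα
  set β := B 0 1
  set γ := B 1 0
  have hα' : derivative α = derivative (B 0 0) - derivative (B 1 1) := by rw [hα, derivative_sub]
  have e01 : α * b = a * β + C ħ * (M 0 1 - derivative β) := by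
    rw [hα, ha']
    linear_combination -l01
  have e00 : 2 * (γ * b) = 2 * (β * c) + C ħ * derivative α - 2 * (C ħ * M 0 0) := by
    rw [hα']
    linear_combination l00 - l11 + C ħ * htr
  have edis : a * (C ħ * derivative α) + 2 * (C ħ * derivative β * c + b * (C ħ * derivative γ)) =
      C ħ * (a * (M 0 0 - M 1 1) + 2 * (M 0 1 * c + b * M 1 0)) := by
    rw [hα']
    linear_combination -a * (l00 - l11) - 2 * c * l01 - 2 * b * l10
  have hcoef : ∀ n, g ≤ n →
      (a * derivative α + 2 * (derivative β * c + derivative γ * b)).coeff n = 0 := by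
    intro n hn
    have h1 : C ħ * (a * derivative α + 2 * (derivative β * c + derivative γ * b)) =
        C ħ * (a * (M 0 0 - M 1 1) + 2 * (M 0 1 * c + b * M 1 0)) := by
      rw [← edis]
      ring
    rw [mul_left_cancel₀ hC h1, hdiscr n hn]
  have hβ : β = 0 := by
    by_contra hβ0
    set n := β.natDegree with hn
    have hβn : β.coeff n ≠ 0 := by
      rw [hn, coeff_natDegree]
      exact leadingCoeff_ne_zero.mpr hβ0
    have hβ1 : ∀ k, n < k → β.coeff k = 0 := fun k hk => coeff_eq_zero_of_natDegree_lt hk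
    have hβ' : ∀ k, n ≤ k → (derivative β).coeff k = 0 := fun k hk => by
      rw [coeff_derivative, hβ1 _ (by omega), zero_mul]
    have hα0 : ∀ k, n ≤ k → α.coeff k = 0 := fun k hk => by
      refine coeff_eq_zero_of_mul hb (by rw [hb1]; exact one_ne_zero) (fun k hk => ?_) hk
      rw [e01, coeff_add, coeff_C_mul, coeff_sub, coeff_mul_eq_zero_of_le ha hβ1 (by omega),
        hM1 _ (by omega), hβ' _ (by omega)]
      ring
    have hα1 : ∀ k, n ≤ k + 1 → (derivative α).coeff k = 0 := fun k hk => by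
      rw [coeff_derivative, hα0 _ hk, zero_mul]
    have htwo : ∀ (p : ℂ[X]) k, (2 * p).coeff k = 2 * p.coeff k := fun p k => by
      rw [← C_ofNat, coeff_C_mul]
    have hγb : ∀ k, n + g ≤ k → (γ * b).coeff k = (β * c).coeff k := fun k hk => by
      have h1 := congrArg (fun p => p.coeff k) e00
      simp only [coeff_add, coeff_sub, coeff_C_mul, htwo] at h1
      rw [hα1 _ (by omega), hM0 _ (by omega)] at h1
      linear_combination h1 / 2
    have hγ0 : ∀ k, n + 2 ≤ k → γ.coeff k = 0 := fun k hk => by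
      refine coeff_eq_zero_of_mul hb (by rw [hb1]; exact one_ne_zero) (fun k hk => ?_) hk
      rw [hγb _ (by omega)]
      exact coeff_mul_eq_zero_of_le (m := n + 1) (fun k hk => hβ1 k hk) hc (by omega)
    have hγ1 : γ.coeff (n + 1) = β.coeff n * (L 1 0).coeff (g + 1) := by
      have h1 := coeff_mul_add (p := γ) (m := n + 1) (fun k hk => hγ0 k hk) hb
      rw [hγb _ (by omega), hb1, mul_one, show n + 1 + g = n + (g + 1) by ring,
        coeff_mul_add hβ1 hc] at h1
      exact h1.symm
    have h1 : (a * derivative α).coeff (g + n) = 0 :=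
      coeff_mul_eq_zero_of_le ha (fun k hk => hα1 k (by omega)) le_rfl
    have h2 : (derivative γ * b).coeff (g + n) = (n + 1) * (β.coeff n * (L 1 0).coeff (g + 1)) := by
      rw [add_comm, coeff_mul_add (fun k hk => by
        rw [coeff_derivative, hγ0 _ (by omega), zero_mul]) hb, hb1, coeff_derivative, hγ1]
      ring
    have h3 : (derivative β * c).coeff (g + n) = n * (β.coeff n * (L 1 0).coeff (g + 1)) := by
      have hX : ∀ k, (X * derivative β).coeff k = k * β.coeff k := by
        rintro (_ | k)
        · simp
        · rw [coeff_X_mul, coeff_derivative]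
          push_cast
          ring
      rw [← coeff_X_mul, ← mul_assoc, show g + n + 1 = n + (g + 1) by ring,
        coeff_mul_add (fun k hk => by rw [hX, hβ1 k hk, mul_zero]) hc, hX]
      ring
    have h4 := hcoef (g + n) (by omega)
    rw [coeff_add, htwo, coeff_add, h1, h2, h3] at h4
    have h5 : (((2 * n + 1 : ℕ) : ℂ)) * (β.coeff n * (L 1 0).coeff (g + 1)) = 0 := by
      push_cast
      linear_combination h4 / 2
    exact mul_ne_zero (Nat.cast_ne_zero.mpr (by omega)) (mul_ne_zero hβn hc1) h5
  have hb0 : b ≠ 0 := fun h => by simp [h] at hb1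
  rw [hβ, derivative_zero, sub_zero, mul_zero, zero_add] at e01
  have hα0 : α = 0 := by
    ext k
    refine coeff_eq_zero_of_mul (m := 0) hb (by rw [hb1]; exact one_ne_zero)
      (fun k hk => ?_) (Nat.zero_le k)
    rw [e01, coeff_C_mul, hM1 _ (by omega), mul_zero]
  have hM01 : M 0 1 = 0 := by
    rw [hα0, zero_mul] at e01
    exact (mul_eq_zero.mp e01.symm).resolve_left hC
  rw [hβ, hα0, derivative_zero, zero_mul, mul_zero, mul_zero, add_zero, zero_sub] at e00
  have hγ0 : γ = 0 := by
    ext k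
    refine coeff_eq_zero_of_mul (m := 0) hb (by rw [hb1]; exact one_ne_zero)
      (fun k hk => ?_) (Nat.zero_le k)
    have h1 : γ * b = -(C ħ * M 0 0) :=
      mul_left_cancel₀ (two_ne_zero : (2 : ℂ[X]) ≠ 0) (by rw [e00]; ring)
    rw [h1, coeff_neg, coeff_C_mul, hM0 _ (by omega), mul_zero, neg_zero]
  have hM00 : M 0 0 = 0 := by
    rw [hγ0, zero_mul, mul_zero] at e00
    have h1 : 2 * (C ħ * M 0 0) = 0 := by linear_combination e00
    exact (mul_eq_zero.mp ((mul_eq_zero.mp h1).resolve_left two_ne_zero)).resolve_left hC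
  have hM10 : M 1 0 = 0 := by
    have h1 : C ħ * M 1 0 = 0 := by
      rw [l10, hγ0, derivative_zero]
      linear_combination -c * hα0 + c * hα
    exact (mul_eq_zero.mp h1).resolve_left hC
  ext1 i j
  fin_cases i <;> fin_cases j
  · exact hM00
  · exact hM01
  · exact hM10
  · simpa [hM00] using htr

/-! ### Differentiation of polynomials along a curve -/

lemma eval_eq_sum_of_coeff_eq_zero {p : ℂ[X]} {N : ℕ} (h : ∀ n, N ≤ n → p.coeff n = 0) (x : ℂ) :
    p.eval x = ∑ n ∈ Finset.range N, p.coeff n * x ^ n := by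
  refine (eval_eq_sum_range' (n := N + 1) ?_ x).trans ?_
  · exact Nat.lt_succ_of_le (natDegree_le_iff_coeff_eq_zero.mpr fun n hn => h n hn.le)
  · rw [Finset.sum_range_succ, h N le_rfl, zero_mul, add_zero]

/-- The coefficients of the polynomials `P r`, `r : ℂ`, are differentiable at `r = 0`, with
derivatives the coefficients of `P'`. -/
def HasCoeffDerivAt (P : ℂ → ℂ[X]) (P' : ℂ[X]) : Prop :=
  ∀ n, HasDerivAt (fun r => (P r).coeff n) (P'.coeff n) 0

namespace HasCoeffDerivAt

variable {P Q : ℂ → ℂ[X]} {P' Q' : ℂ[X]}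

lemma add (hP : HasCoeffDerivAt P P') (hQ : HasCoeffDerivAt Q Q') :
    HasCoeffDerivAt (fun r => P r + Q r) (P' + Q') := fun n => by
  simp only [coeff_add]
  exact (hP n).add (hQ n)

lemma sub (hP : HasCoeffDerivAt P P') (hQ : HasCoeffDerivAt Q Q') :
    HasCoeffDerivAt (fun r => P r - Q r) (P' - Q') := fun n => by
  simp only [coeff_sub]
  exact (hP n).sub (hQ n)

lemma mul (hP : HasCoeffDerivAt P P') (hQ : HasCoeffDerivAt Q Q') :
    HasCoeffDerivAt (fun r => P r * Q r) (P' * Q 0 + P 0 * Q') := fun n => by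
  simp only [coeff_add, coeff_mul, ← Finset.sum_add_distrib]
  exact HasDerivAt.fun_sum fun ij _ => (hP ij.1).mul (hQ ij.2)

/-- The derivative of `r ↦ P r (ξ r)`, if the degrees of the polynomials are bounded. -/
lemma eval (hP : HasCoeffDerivAt P P') {N : ℕ}
    (hN : ∀ᶠ r in nhds 0, ∀ n, N ≤ n → (P r).coeff n = 0) {ξ : ℂ → ℂ} {ξ' : ℂ}
    (hξ : HasDerivAt ξ ξ' 0) :
    HasDerivAt (fun r => (P r).eval (ξ r))
      (P'.eval (ξ 0) + (derivative (P 0)).eval (ξ 0) * ξ') 0 := by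
  have hP' : ∀ n, N ≤ n → P'.coeff n = 0 := fun n hn =>
    (hP n).unique ((hasDerivAt_const (0 : ℂ) (0 : ℂ)).congr_of_eventuallyEq
      (hN.mono fun r hr => hr n hn))
  have hder : (derivative (P 0)).eval (ξ 0) =
      ∑ n ∈ Finset.range N, (P 0).coeff n * (n * ξ 0 ^ (n - 1)) := by
    have h1 : P 0 = ∑ n ∈ Finset.range N, monomial n ((P 0).coeff n) := by
      refine ((P 0).as_sum_range' (N + 1) ?_).trans ?_
      · exact Nat.lt_succ_of_le
          (natDegree_le_iff_coeff_eq_zero.mpr fun n hn => hN.self_of_nhds n hn.le)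
      · rw [Finset.sum_range_succ, hN.self_of_nhds N le_rfl, map_zero, add_zero]
    conv_lhs => rw [h1]
    simp only [derivative_sum, eval_finsetSum, derivative_monomial, eval_monomial]
    exact Finset.sum_congr rfl fun n _ => by ring
  have h : HasDerivAt (fun r => ∑ n ∈ Finset.range N, (P r).coeff n * ξ r ^ n)
      (∑ n ∈ Finset.range N, (P'.coeff n * ξ 0 ^ n +
        (P 0).coeff n * (n * ξ 0 ^ (n - 1) * ξ'))) 0 :=
    HasDerivAt.fun_sum fun n _ => (hP n).mul (hξ.pow n)
  have h2 := h.congr_of_eventuallyEq (f₁ := fun r => (P r).eval (ξ r))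
    (hN.mono fun r hr => eval_eq_sum_of_coeff_eq_zero hr (ξ r))
  refine h2.congr_deriv ?_
  rw [eval_eq_sum_of_coeff_eq_zero hP', hder, Finset.sum_mul, ← Finset.sum_add_distrib]
  exact Finset.sum_congr rfl fun n _ => by ring

end HasCoeffDerivAt

end

/-! ### Isomonodromic families along the trivial deformations -/

section

variable {g : ℕ}

lemma irregTime_add_smul (t v : IrregularTimes g) (r : ℂ) (k : ℕ) :
    irregTime (t + r • v) k = irregTime t k + r * irregTime v k := by
  unfold irregTime
  split_ifs <;> simp

lemma irregTime_vecW {k : ℕ} (hk : k ∈ Finset.Icc 1 (g + 2)) (m : ℕ) :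
    irregTime (vecW g k) m = if m = 2 * k then 1 else 0 := by
  rw [Finset.mem_Icc] at hk
  by_cases h : 1 ≤ m ∧ m ≤ 2 * g + 4
  · rw [irregTime, dif_pos h, vecW]
    simp only [Nat.sub_add_cancel h.1]
  · rw [irregTime, dif_neg h, if_neg (by omega)]

lemma irregTime_vecU_neg_one (t : IrregularTimes g) (m : ℕ) :
    irregTime (vecU (-1) t) m = m / 2 * irregTime t m := by
  by_cases h : 1 ≤ m ∧ m ≤ 2 * g + 4
  · rw [irregTime, dif_pos h, vecU]
    have h1 : (((m - 1 : ℕ) : ℤ) + 1 + 2 * (-1) + 2).toNat = m := by omega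
    have h2 : (((m - 1 : ℕ) : ℂ)) + 1 = m := by
      rw [← Nat.cast_succ, Nat.succ_eq_add_one, Nat.sub_add_cancel h.1]
    simp only [h1, h2]
    ring
  · rw [irregTime, irregTime, dif_neg h, dif_neg h, mul_zero]

lemma irregTime_vecU_zero (t : IrregularTimes g) (m : ℕ) :
    irregTime (vecU 0 t) m = m / 2 * irregTime t (m + 2) := by
  by_cases h : 1 ≤ m ∧ m ≤ 2 * g + 4
  · rw [irregTime, dif_pos h, vecU]
    have h1 : (((m - 1 : ℕ) : ℤ) + 1 + 2 * 0 + 2).toNat = m + 2 := by omega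
    have h2 : (((m - 1 : ℕ) : ℂ)) + 1 = m := by
      rw [← Nat.cast_succ, Nat.succ_eq_add_one, Nat.sub_add_cancel h.1]
    simp only [h1, h2]
    ring
  · rw [irregTime, dif_neg h]
    rcases Nat.eq_zero_or_pos m with rfl | hm
    · simp
    · rw [irregTime_of_lt t (by omega), mul_zero]

lemma hasDerivAt_irregTime (t v : IrregularTimes g) (k : ℕ) :
    HasDerivAt (fun r : ℂ => irregTime (t + r • v) k) (irregTime v k) 0 := by
  simp only [irregTime_add_smul]
  simpa using ((hasDerivAt_id (0 : ℂ)).mul_const (irregTime v k)).const_add (irregTime t k)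

lemma hasCoeffDerivAt_oddPoly (t v : IrregularTimes g) :
    HasCoeffDerivAt (fun r => oddPoly (t + r • v)) (oddPoly v) := fun n => by
  simpa only [coeff_oddPoly] using hasDerivAt_irregTime t v (2 * n + 1)

lemma apply_eq_sum_single (φ : IrregularTimes g →L[ℂ] ℂ) (v : IrregularTimes g) :
    φ v = ∑ k, v k * φ (Pi.single k 1) := by
  conv_lhs => rw [← Finset.univ_sum_single v]
  rw [map_sum]
  refine Finset.sum_congr rfl fun k _ => ?_
  have h : Pi.single k (v k) = v k • (Pi.single k 1 : IrregularTimes g) := by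
    rw [← Pi.single_smul, smul_eq_mul, mul_one]
  rw [h, map_smul, smul_eq_mul]

lemma deformation_eq (ħ : ℂ) (α : IrregularTimes g) (f : IrregularTimes g → ℂ)
    (t : IrregularTimes g) : deformation ħ α f t = ħ * fderiv ℂ f t α := by
  rw [deformation, apply_eq_sum_single]
  rfl

lemma eventually_add_smul_mem {U : Set (IrregularTimes g)} (hU : IsOpen U) {t : IrregularTimes g}
    (ht : t ∈ U) (v : IrregularTimes g) : ∀ᶠ r : ℂ in nhds 0, t + r • v ∈ U := by
  have hc : Continuous fun r : ℂ => t + r • v := by fun_prop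
  exact hc.continuousAt.eventually_mem (hU.mem_nhds (by simpa using ht))

section Family

variable {ħ : ℂ} {U : Set (IrregularTimes g)}
  {L : IrregularTimes g → Matrix (Fin 2) (Fin 2) ℂ[X]} {t : IrregularTimes g}

/-- Along every direction the derivative of an isomonodromic family is given by a Lax equation. -/
lemma IsIsomonodromicFamily.exists_lax (hħ : ħ ≠ 0) (hU : IsOpen U)
    (hL : IsIsomonodromicFamily ħ U L) (ht : t ∈ U) (v : IrregularTimes g) :
    ∃ B D : Matrix (Fin 2) (Fin 2) ℂ[X],
      (∀ a b, C ħ * D a b = (B * L t - L t * B) a b + C ħ * derivative (B a b)) ∧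
      ∀ a b, HasCoeffDerivAt (fun r => L (t + r • v) a b) (D a b) := by
  choose A hA using hL.lax t ht
  have hC : C ħ * C ħ⁻¹ = (1 : ℂ[X]) := by rw [← C_mul, mul_inv_cancel₀ hħ, C_1]
  refine ⟨∑ k, v k • A k, Matrix.of fun a b => C ħ⁻¹ * ((∑ k, v k • A k) * L t -
    L t * ∑ k, v k • A k) a b + derivative ((∑ k, v k • A k) a b), fun a b => ?_, fun a b m => ?_⟩
  · rw [Matrix.of_apply, mul_add, ← mul_assoc, hC, one_mul]
  · have hd := ((hL.differentiableOn a b m).differentiableAt (hU.mem_nhds ht)).hasFDerivAt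
    refine (hd.hasLineDerivAt v).congr_deriv ?_
    rw [apply_eq_sum_single, Finset.sum_mul, Finset.mul_sum, ← Finset.sum_sub_distrib,
      Matrix.of_apply, Matrix.sum_apply, Matrix.sum_apply, coeff_add, coeff_C_mul, finsetSum_coeff,
      derivative_sum, finsetSum_coeff, Finset.mul_sum, ← Finset.sum_add_distrib]
    refine Finset.sum_congr rfl fun k _ => ?_
    have h1 := hA k a b m
    rw [smul_mul_assoc, mul_smul_comm, ← smul_sub, Matrix.smul_apply, Matrix.smul_apply,
      derivative_smul, coeff_smul, coeff_smul, smul_eq_mul, smul_eq_mul]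
    have h2 : fderiv ℂ (fun t' => (L t' a b).coeff m) t (Pi.single k 1) = ħ⁻¹ *
        (((A k * L t - L t * A k) a b).coeff m + ħ * (derivative (A k a b)).coeff m) := by
      rw [← h1, inv_mul_cancel_left₀ hħ]
      rfl
    rw [h2]
    field_simp

/-- A solution `Y` of the Lax equation with the same effect on the normalization, the trace and
the upper half of the discriminant as the direction `v` is the derivative of the family along
`v`. -/
lemma IsIsomonodromicFamily.hasCoeffDerivAt_of_lax (hħ : ħ ≠ 0) (hU : IsOpen U)
    (hne : ∀ t ∈ U, irregTime t (2 * g + 3) ≠ 0)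
    (hL : IsIsomonodromicFamily ħ U L) (ht : t ∈ U) (v : IrregularTimes g)
    (B₀ Y : Matrix (Fin 2) (Fin 2) ℂ[X])
    (hlax : ∀ a b, C ħ * Y a b = (B₀ * L t - L t * B₀) a b + C ħ * derivative (B₀ a b))
    (htr : ∀ n, (Y 0 0 + Y 1 1).coeff n = -irregTime v (2 * n + 2))
    (h0 : ∀ n, g ≤ n → (Y 0 0 - Y 1 1).coeff n = 0)
    (h1 : ∀ n, g ≤ n → (Y 0 1).coeff n = 0)
    (hdiscr : ∀ n, g ≤ n →
      (2 * ((L t 0 0 - L t 1 1) * (Y 0 0 - Y 1 1) +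
        2 * (Y 0 1 * L t 1 0 + L t 0 1 * Y 1 0))).coeff n =
        (2 * (oddPoly t * oddPoly v)).coeff (n + 1)) (a b : Fin 2) :
    HasCoeffDerivAt (fun r => L (t + r • v) a b) (Y a b) := by
  obtain ⟨B, D, hBD, hD⟩ := hL.exists_lax hħ hU ht v
  have hev := eventually_add_smul_mem hU ht v
  have hnorm := hL.normalized t ht
  have htd : ∀ t' ∈ U, _ := fun t' ht' =>
    (hL.irregularType t' ht').trace_discr hħ (hne t' ht') (hL.normalized t' ht')
  have hz : t + (0 : ℂ) • v = t := by simp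
  have dtr : ∀ n, (D 0 0 + D 1 1).coeff n = -irregTime v (2 * n + 2) := fun n =>
    (((hD 0 0).add (hD 1 1)) n).unique ((hasDerivAt_irregTime t v (2 * n + 2)).neg
      |>.congr_of_eventuallyEq (hev.mono fun r hr => (htd _ hr).1 n))
  have d0 : ∀ n, g ≤ n → (D 0 0 - D 1 1).coeff n = 0 := fun n hn =>
    (((hD 0 0).sub (hD 1 1)) n).unique ((hasDerivAt_const (0 : ℂ) (0 : ℂ)).congr_of_eventuallyEq
      (hev.mono fun r hr => (hL.normalized _ hr).coeff_sub hn))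
  have d1 : ∀ n, g ≤ n → (D 0 1).coeff n = 0 := by
    intro n hn
    rcases hn.lt_or_eq with h | rfl
    · exact (hD 0 1 n).unique ((hasDerivAt_const (0 : ℂ) (0 : ℂ)).congr_of_eventuallyEq
        (hev.mono fun r hr => (hL.normalized _ hr).coeff_zero_one h))
    · exact (hD 0 1 g).unique ((hasDerivAt_const (0 : ℂ) (1 : ℂ)).congr_of_eventuallyEq
        (hev.mono fun r hr => (hL.normalized _ hr).coeff_zero_one_top))
  have ddiscr : ∀ n, g ≤ n →
      (2 * ((L t 0 0 - L t 1 1) * (D 0 0 - D 1 1) +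
        2 * (D 0 1 * L t 1 0 + L t 0 1 * D 1 0))).coeff n =
        (2 * (oddPoly t * oddPoly v)).coeff (n + 1) := by
    intro n hn
    have ha := (hD 0 0).sub (hD 1 1)
    have hbc := (hD 0 1).mul (hD 1 0)
    have hd := (ha.mul ha).add ((hbc.add hbc).add (hbc.add hbc))
    have ho := (hasCoeffDerivAt_oddPoly t v).mul (hasCoeffDerivAt_oddPoly t v)
    have hu := (hd n).unique ((ho (n + 1)).congr_of_eventuallyEq (hev.mono fun r hr => ?_))
    · simp only [hz] at hu
      rw [show 2 * (oddPoly t * oddPoly v) = oddPoly v * oddPoly t + oddPoly t * oddPoly v by ring,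
        ← hu]
      congr 1
      ring
    · have := (htd _ hr).2 n hn
      rw [sq] at this
      refine (congrArg (fun p : ℂ[X] => p.coeff n) ?_).trans this
      simp only [discr]
      ring
  have hM : (Matrix.of fun a b => D a b - Y a b) = 0 := by
    refine eq_zero_of_lax hħ (L := L t) (B := B - B₀) (fun n hn => hnorm.coeff_sub hn)
      (fun n hn => hnorm.coeff_zero_one hn) hnorm.coeff_zero_one_top
      (fun n hn => hnorm.coeff_eq_zero _ _ hn) ?_ (fun a b => ?_) ?_ (fun n hn => ?_)
      (fun n hn => ?_) (fun n hn => ?_)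
    · rw [hnorm.coeff_one_zero_top]
      exact div_ne_zero (pow_ne_zero 2 (hne t ht)) (by norm_num)
    · rw [Matrix.of_apply, mul_sub, hBD, hlax, sub_mul, mul_sub]
      simp only [Matrix.sub_apply, derivative_sub]
      ring
    · ext n
      have := dtr n
      rw [← htr n] at this
      simp only [Matrix.of_apply, coeff_add, coeff_sub, coeff_zero] at this ⊢
      linear_combination this
    · have e1 := dtr n
      rw [← htr n] at e1
      have e2 := d0 n hn
      rw [← h0 n hn] at e2
      simp only [Matrix.of_apply, coeff_add, coeff_sub] at e1 e2 ⊢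
      linear_combination (e1 + e2) / 2
    · rw [Matrix.of_apply, coeff_sub, d1 n hn, h1 n hn, sub_zero]
    · have e := ddiscr n hn
      rw [← hdiscr n hn, ← sub_eq_zero, ← coeff_sub] at e
      have htwo : ∀ p : ℂ[X], (2 * p).coeff n = 2 * p.coeff n := fun p => by
        rw [← C_ofNat, coeff_C_mul]
      simp only [Matrix.of_apply]
      refine mul_left_cancel₀ (two_ne_zero : (2 : ℂ) ≠ 0) ?_
      rw [← htwo, mul_zero, ← e]
      congr 1
      ring
  have := congrFun (congrFun hM a) b
  rw [Matrix.of_apply, Matrix.zero_apply, sub_eq_zero] at this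
  rw [← this]
  exact hD a b

lemma IsIsomonodromicFamily.hasCoeffDerivAt_vecW (hħ : ħ ≠ 0) (hU : IsOpen U)
    (hne : ∀ t ∈ U, irregTime t (2 * g + 3) ≠ 0)
    (hL : IsIsomonodromicFamily ħ U L) (ht : t ∈ U) {k : ℕ} (hk : k ∈ Finset.Icc 1 (g + 2)) :
    HasCoeffDerivAt (fun r => L (t + r • vecW g k) 0 1) 0 ∧
    HasCoeffDerivAt (fun r => L (t + r • vecW g k) 0 0 - L (t + r • vecW g k) 1 1) 0 := by
  have hk1 := (Finset.mem_Icc.mp hk).1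
  have hodd : oddPoly (vecW g k) = 0 := by
    ext n
    rw [coeff_oddPoly, irregTime_vecW hk, if_neg (by omega), coeff_zero]
  have h := hL.hasCoeffDerivAt_of_lax hħ hU hne ht (vecW g k)
    (Matrix.diagonal fun _ => monomial k (-1 / (2 * (k : ℂ))))
    (Matrix.diagonal fun _ => monomial (k - 1) (-1 / 2 : ℂ)) (fun a b => ?_) (fun n => ?_)
    (fun n _ => by simp) (fun n _ => by simp) (fun n hn => ?_)
  · have h00 := h 0 0
    have h11 := h 1 1
    have h01 := h 0 1
    simp only [Matrix.diagonal_apply, if_true, Fin.isValue, zero_ne_one, if_false] at h00 h11 h01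
    refine ⟨h01, ?_⟩
    have := h00.sub h11
    rwa [sub_self] at this
  · have hcomm : (Matrix.diagonal fun _ : Fin 2 => monomial k (-1 / (2 * (k : ℂ)))) * L t -
        L t * (Matrix.diagonal fun _ => monomial k (-1 / (2 * (k : ℂ)))) = 0 := by
      ext1 i j
      rw [Matrix.sub_apply, Matrix.diagonal_mul, Matrix.mul_diagonal, mul_comm, sub_self,
        Matrix.zero_apply]
    have hk0 : (k : ℂ) ≠ 0 := Nat.cast_ne_zero.mpr (by omega)
    rw [hcomm, Matrix.zero_apply, zero_add, Matrix.diagonal_apply, Matrix.diagonal_apply]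
    split_ifs
    · rw [derivative_monomial]
      congr 2
      field_simp
    · simp
  · rw [irregTime_vecW hk]
    simp only [Matrix.diagonal_apply_eq, coeff_add, coeff_monomial]
    by_cases h : k - 1 = n
    · rw [if_pos h, if_pos (by omega)]
      norm_num
    · rw [if_neg h, if_neg (by omega)]
      norm_num
  · simp [hodd]

/-- The square of the generating polynomial of the odd times, differentiated along the
translations. -/
lemma coeff_oddPoly_mul_vecU_zero (t : IrregularTimes g) {n : ℕ} (hn : g ≤ n) :
    (2 * (oddPoly t * oddPoly (vecU 0 t))).coeff (n + 1) =
      (n + 1) * (oddPoly t ^ 2).coeff (n + 2) := by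
  have h1 : 2 * (X * oddPoly (vecU 0 t)) =
      2 * (X * derivative (oddPoly t)) - oddPoly t + C (irregTime t 1) := by
    ext k
    rw [← C_ofNat, coeff_C_mul, coeff_add, coeff_sub, coeff_C_mul]
    rcases k with _ | k
    · simp [coeff_oddPoly]
    · rw [coeff_X_mul, coeff_X_mul, coeff_derivative, coeff_oddPoly, coeff_oddPoly,
        irregTime_vecU_zero, coeff_C_of_ne_zero (by omega),
        show 2 * k + 1 + 2 = 2 * (k + 1) + 1 by ring]
      push_cast
      ring
  have h2 : X * (2 * (oddPoly t * oddPoly (vecU 0 t))) =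
      X * derivative (oddPoly t ^ 2) - oddPoly t ^ 2 + C (irregTime t 1) * oddPoly t := by
    rw [derivative_pow]
    simp only [Nat.cast_ofNat, C_ofNat]
    linear_combination oddPoly t * h1
  have h3 := congrArg (fun p => p.coeff (n + 2)) h2
  simp only [coeff_X_mul, coeff_add, coeff_sub, coeff_C_mul, coeff_derivative] at h3
  rw [h3, coeff_oddPoly t (n + 2), irregTime_of_lt t (k := 2 * (n + 2) + 1) (by omega)]
  push_cast
  ring

/-- The square of the generating polynomial of the odd times, differentiated along the
dilations. -/
lemma coeff_oddPoly_mul_vecU_neg_one (t : IrregularTimes g) (n : ℕ) :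
    (2 * (oddPoly t * oddPoly (vecU (-1) t))).coeff (n + 1) =
      (n + 2) * (oddPoly t ^ 2).coeff (n + 1) := by
  have h1 : 2 * oddPoly (vecU (-1) t) = 2 * (X * derivative (oddPoly t)) + oddPoly t := by
    ext k
    rw [← C_ofNat, coeff_C_mul, coeff_add, coeff_C_mul, coeff_oddPoly, coeff_oddPoly,
      irregTime_vecU_neg_one]
    rcases k with _ | k
    · simp
    · rw [coeff_X_mul, coeff_derivative, coeff_oddPoly]
      push_cast
      ring
  have h2 : 2 * (oddPoly t * oddPoly (vecU (-1) t)) =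
      X * derivative (oddPoly t ^ 2) + oddPoly t ^ 2 := by
    rw [derivative_pow]
    simp only [Nat.cast_ofNat, C_ofNat]
    linear_combination oddPoly t * h1
  rw [h2, coeff_add, coeff_X_mul, coeff_derivative]
  ring

lemma derivative_discr (M : Matrix (Fin 2) (Fin 2) ℂ[X]) :
    derivative (discr M) = 2 * ((M 0 0 - M 1 1) * (derivative (M 0 0) - derivative (M 1 1)) +
        2 * (derivative (M 0 1) * M 1 0 + M 0 1 * derivative (M 1 0))) := by
  rw [discr, ← C_ofNat]
  simp only [derivative_add, derivative_sub, derivative_mul, derivative_pow, derivative_C]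
  simp only [Nat.cast_ofNat, C_ofNat]
  ring

lemma IsIsomonodromicFamily.hasCoeffDerivAt_vecU_zero (hħ : ħ ≠ 0) (hU : IsOpen U)
    (hne : ∀ t ∈ U, irregTime t (2 * g + 3) ≠ 0)
    (hL : IsIsomonodromicFamily ħ U L) (ht : t ∈ U) :
    HasCoeffDerivAt (fun r => L (t + r • vecU 0 t) 0 1) (derivative (L t 0 1)) ∧
    HasCoeffDerivAt (fun r => L (t + r • vecU 0 t) 0 0 - L (t + r • vecU 0 t) 1 1)
      (derivative (L t 0 0 - L t 1 1)) := by
  have hnorm := hL.normalized t ht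
  obtain ⟨htr, hdi⟩ := (hL.irregularType t ht).trace_discr hħ (hne t ht) hnorm
  have h := hL.hasCoeffDerivAt_of_lax hħ hU hne ht (vecU 0 t) (L t)
    ((L t).map derivative) (fun a b => by simp) (fun n => ?_) (fun n hn => ?_) (fun n hn => ?_)
    (fun n hn => ?_)
  · refine ⟨h 0 1, ?_⟩
    rw [derivative_sub]
    exact (h 0 0).sub (h 1 1)
  · simp only [Matrix.map_apply]
    rw [← derivative_add, coeff_derivative, htr, irregTime_vecU_zero,
      show 2 * (n + 1) + 2 = 2 * n + 2 + 2 by ring]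
    push_cast
    ring
  · simp only [Matrix.map_apply]
    rw [← derivative_sub, coeff_derivative, hnorm.coeff_sub (by omega), zero_mul]
  · rw [Matrix.map_apply, coeff_derivative, hnorm.coeff_zero_one (by omega), zero_mul]
  · simp only [Matrix.map_apply]
    rw [← derivative_discr, coeff_derivative, coeff_oddPoly_mul_vecU_zero t hn,
      hdi _ (by omega)]
    ring

lemma IsIsomonodromicFamily.hasCoeffDerivAt_vecU_neg_one (hħ : ħ ≠ 0) (hU : IsOpen U)
    (hne : ∀ t ∈ U, irregTime t (2 * g + 3) ≠ 0)
    (hL : IsIsomonodromicFamily ħ U L) (ht : t ∈ U) :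
    HasCoeffDerivAt (fun r => L (t + r • vecU (-1) t) 0 1)
      (X * derivative (L t 0 1) - C (g : ℂ) * L t 0 1) ∧
    HasCoeffDerivAt (fun r => L (t + r • vecU (-1) t) 0 0 - L (t + r • vecU (-1) t) 1 1)
      (X * derivative (L t 0 0 - L t 1 1) + (L t 0 0 - L t 1 1)) := by
  have hnorm := hL.normalized t ht
  obtain ⟨htr, hdi⟩ := (hL.irregularType t ht).trace_discr hħ (hne t ht) hnorm
  have hX : ∀ (p : ℂ[X]) k, (X * derivative p).coeff k = k * p.coeff k := by
    rintro p (_ | k)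
    · simp
    · rw [coeff_X_mul, coeff_derivative]
      push_cast
      ring
  -- the dilation has to be followed by a diagonal gauge transformation, so that `L₁₂` stays monic
  have h := hL.hasCoeffDerivAt_of_lax hħ hU hne ht (vecU (-1) t)
    !![X * L t 0 0 - C (ħ * (g + 1) / 2), X * L t 0 1;
       X * L t 1 0, X * L t 1 1 + C (ħ * (g + 1) / 2)]
    !![X * derivative (L t 0 0) + L t 0 0, X * derivative (L t 0 1) - C (g : ℂ) * L t 0 1;
       X * derivative (L t 1 0) + C ((g : ℂ) + 2) * L t 1 0, X * derivative (L t 1 1) + L t 1 1]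
    (fun a b => ?_) (fun n => ?_) (fun n hn => ?_) (fun n hn => ?_) (fun n hn => ?_)
  · refine ⟨h 0 1, ?_⟩
    have h2 := (h 0 0).sub (h 1 1)
    have e : X * derivative (L t 0 0 - L t 1 1) + (L t 0 0 - L t 1 1) =
        (X * derivative (L t 0 0) + L t 0 0) - (X * derivative (L t 1 1) + L t 1 1) := by
      rw [derivative_sub]
      ring
    rw [e]
    exact h2
  · have hCg : C (ħ * ((g : ℂ) + 1) / 2) * 2 = C ħ * (C (g : ℂ) + 1) := by
      rw [← C_ofNat, ← C_mul, ← C_1, ← C_add, ← C_mul]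
      congr 1
      ring
    have hCg2 : C ((g : ℂ) + 2) = C (g : ℂ) + 2 := by rw [C_add, C_ofNat]
    simp only [Matrix.sub_apply, Matrix.mul_apply, Fin.sum_univ_two]
    fin_cases a <;> fin_cases b <;>
      simp only [Fin.zero_eta, Fin.mk_one, Fin.isValue, Matrix.of_apply, Matrix.cons_val',
        Matrix.cons_val_zero, Matrix.cons_val_one, Matrix.cons_val_fin_one, derivative_sub,
        derivative_add, derivative_mul, derivative_X, derivative_C]
    · ring
    · linear_combination L t 0 1 * hCg
    · rw [hCg2]
      linear_combination -L t 1 0 * hCg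
    · ring
  · change (X * derivative (L t 0 0) + L t 0 0 + (X * derivative (L t 1 1) + L t 1 1)).coeff n = _
    have := htr n
    rw [coeff_add] at this
    simp only [coeff_add, hX]
    rw [irregTime_vecU_neg_one]
    push_cast
    linear_combination (n + 1 : ℂ) * this
  · change (X * derivative (L t 0 0) + L t 0 0 - (X * derivative (L t 1 1) + L t 1 1)).coeff n = _
    have := hnorm.coeff_sub hn
    rw [coeff_sub] at this
    simp only [coeff_add, coeff_sub, hX]
    linear_combination (n + 1 : ℂ) * this
  · change (X * derivative (L t 0 1) - C (g : ℂ) * L t 0 1).coeff n = 0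
    rw [coeff_sub, hX, coeff_C_mul]
    rcases hn.lt_or_eq with h | rfl
    · rw [hnorm.coeff_zero_one h, mul_zero, mul_zero, sub_zero]
    · ring
  · change (2 * ((L t 0 0 - L t 1 1) * (X * derivative (L t 0 0) + L t 0 0 -
      (X * derivative (L t 1 1) + L t 1 1)) + 2 * ((X * derivative (L t 0 1) -
      C (g : ℂ) * L t 0 1) * L t 1 0 + L t 0 1 * (X * derivative (L t 1 0) +
      C ((g : ℂ) + 2) * L t 1 0)))).coeff n = _
    have e : 2 * ((L t 0 0 - L t 1 1) * (X * derivative (L t 0 0) + L t 0 0 -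
      (X * derivative (L t 1 1) + L t 1 1)) + 2 * ((X * derivative (L t 0 1) -
      C (g : ℂ) * L t 0 1) * L t 1 0 + L t 0 1 * (X * derivative (L t 1 0) +
      C ((g : ℂ) + 2) * L t 1 0))) = X * derivative (discr (L t)) + C 2 * discr (L t) := by
      rw [derivative_discr, discr, C_add, C_ofNat]
      ring
    rw [e, coeff_add, hX, coeff_C_mul, hdi n hn, coeff_oddPoly_mul_vecU_neg_one]
    ring

end Family

end

/-! ### Trivial directions and the shifted connection -/

section

variable {g : ℕ}

/-- On the odd times, the vector `v` is the combination `a u₀ + b u₋₁` of the infinitesimal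
translation and dilation; its even components are arbitrary. -/
def IsTrivialDirection (t v : IrregularTimes g) (a b : ℂ) : Prop :=
  ∀ j : ℕ, irregTime v (2 * j + 1) =
    (j + 1 / 2) * (a * irregTime t (2 * j + 3) + b * irregTime t (2 * j + 1))

lemma isTrivialDirection_vecW (t : IrregularTimes g) {k : ℕ} (hk : k ∈ Finset.Icc 1 (g + 2)) :
    IsTrivialDirection t (vecW g k) 0 0 := fun j => by
  rw [irregTime_vecW hk, if_neg (by omega)]
  ring

lemma isTrivialDirection_vecU_zero (t : IrregularTimes g) :
    IsTrivialDirection t (vecU 0 t) 1 0 := fun j => by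
  rw [irregTime_vecU_zero]
  push_cast
  ring_nf

lemma isTrivialDirection_vecU_neg_one (t : IrregularTimes g) :
    IsTrivialDirection t (vecU (-1) t) 0 1 := fun j => by
  rw [irregTime_vecU_neg_one]
  push_cast
  ring_nf

section Branch

variable {U : Set (IrregularTimes g)} {s : IrregularTimes g → ℂ} {t v : IrregularTimes g} {a b : ℂ}

lemma IsRootBranch.s_ne_zero (hs : IsRootBranch U s) (ht : t ∈ U) : s t ≠ 0 := fun h => by
  have h1 := hs.pow_eq t ht
  rw [h, zero_pow (by omega)] at h1
  exact hs.ne_zero t ht (by linear_combination -2 * h1)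

lemma IsRootBranch.mono {V : Set (IrregularTimes g)} (hs : IsRootBranch U s) (hV : V ⊆ U) :
    IsRootBranch V s :=
  ⟨fun t ht => hs.ne_zero t (hV ht), fun t ht => hs.pow_eq t (hV ht),
    hs.differentiableOn.mono hV⟩

lemma differentiable_irregTime (k : ℕ) :
    Differentiable ℂ fun t : IrregularTimes g => irregTime t k := by
  unfold irregTime
  split_ifs <;> fun_prop

lemma IsRootBranch.differentiableOn_timeT1 (hs : IsRootBranch U s) :
    DifferentiableOn ℂ (timeT1 s) U := by
  have h : Differentiable ℂ fun t : IrregularTimes g =>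
      irregTime t (2 * g + 1) / (2 * (g : ℂ) + 1) := by
    simpa only [div_eq_mul_inv] using (differentiable_irregTime (2 * g + 1)).mul_const _
  exact h.differentiableOn.mul
    ((hs.differentiableOn.pow _).inv fun t ht => pow_ne_zero _ (hs.s_ne_zero ht))

lemma IsRootBranch.differentiableOn_timeT2 (hs : IsRootBranch U s) :
    DifferentiableOn ℂ (timeT2 s) U := hs.differentiableOn.pow 2

lemma IsRootBranch.timeT2_ne_zero (hs : IsRootBranch U s) (ht : t ∈ U) : timeT2 s t ≠ 0 :=
  pow_ne_zero 2 (hs.s_ne_zero ht)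

lemma IsRootBranch.hasDerivAt_s (hU : IsOpen U) (hs : IsRootBranch U s) (ht : t ∈ U)
    (hv : IsTrivialDirection t v a b) :
    HasDerivAt (fun r : ℂ => s (t + r • v)) (b / 2 * s t) 0 := by
  have hd := ((hs.differentiableOn.differentiableAt (hU.mem_nhds ht)).hasFDerivAt).hasLineDerivAt v
  refine hd.congr_deriv ?_
  have h1 := HasDerivAt.pow hd (2 * g + 3)
  have h2 := (hasDerivAt_irregTime t v (2 * g + 3)).div_const 2
  have h3 := h1.unique (h2.congr_of_eventuallyEq
    ((eventually_add_smul_mem hU ht v).mono fun r hr => hs.pow_eq _ hr))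
  have h4 := hv (g + 1)
  rw [show 2 * (g + 1) + 1 = 2 * g + 3 by ring, show 2 * (g + 1) + 3 = 2 * g + 5 by ring,
    irregTime_of_lt t (k := 2 * g + 5) (by omega)] at h4
  have h5 := hs.pow_eq t ht
  have hs0 := hs.s_ne_zero ht
  simp only [zero_smul, add_zero] at h3
  rw [h4, show 2 * g + 3 - 1 = 2 * g + 2 by omega] at h3
  have hg : ((2 * g + 3 : ℕ) : ℂ) ≠ 0 := Nat.cast_ne_zero.mpr (by omega)
  refine mul_left_cancel₀ (mul_ne_zero hg (pow_ne_zero (2 * g + 2) hs0)) (h3.trans ?_)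
  push_cast
  linear_combination -(2 * g + 3) * (b / 2) * h5

lemma IsRootBranch.hasDerivAt_timeT2 (hU : IsOpen U) (hs : IsRootBranch U s) (ht : t ∈ U)
    (hv : IsTrivialDirection t v a b) :
    HasDerivAt (fun r : ℂ => timeT2 s (t + r • v)) (b * timeT2 s t) 0 := by
  refine (HasDerivAt.pow (hs.hasDerivAt_s hU ht hv) 2).congr_deriv ?_
  simp only [zero_smul, add_zero, timeT2]
  push_cast
  ring

lemma IsRootBranch.hasDerivAt_timeT1 (hU : IsOpen U) (hs : IsRootBranch U s) (ht : t ∈ U)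
    (hv : IsTrivialDirection t v a b) :
    HasDerivAt (fun r : ℂ => timeT1 s (t + r • v)) (a * timeT2 s t) 0 := by
  have hs0 := hs.s_ne_zero ht
  have h1 := (hasDerivAt_irregTime t v (2 * g + 1)).div_const (2 * (g : ℂ) + 1)
  have h2 := (HasDerivAt.pow (hs.hasDerivAt_s hU ht hv) (2 * g + 1)).fun_inv
    (pow_ne_zero _ (by simpa using hs0))
  refine (h1.mul h2).congr_deriv ?_
  have h5 := hs.pow_eq t ht
  have hg : (2 * (g : ℂ) + 1) ≠ 0 := by exact_mod_cast (by omega : 2 * g + 1 ≠ 0)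
  simp only [Pi.pow_apply, zero_smul, add_zero, timeT2, Nat.add_sub_cancel]
  have h6 : irregTime t (2 * g + 3) = 2 * s t ^ (2 * g + 3) := by rw [h5]; ring
  rw [hv g, h6]
  push_cast
  have e1 : s t ^ (2 * g + 1) = s t ^ (2 * g) * s t := pow_succ _ _
  have e2 : s t ^ (2 * g + 3) = s t ^ (2 * g) * s t ^ 3 := pow_add _ _ _
  have hs1 : s t ^ (2 * g) ≠ 0 := pow_ne_zero _ hs0
  have e3 : (g : ℂ) + 1 / 2 = (2 * (g : ℂ) + 1) / 2 := by ring
  rw [e1, e2, e3]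
  generalize 2 * (g : ℂ) + 1 = w at hg
  field_simp
  ring

end Branch

lemma differentiableOn_eval {E : Type*} [NormedAddCommGroup E] [NormedSpace ℂ E] {U : Set E}
    {P : E → ℂ[X]} {N : ℕ} (hP : ∀ n, DifferentiableOn ℂ (fun t => (P t).coeff n) U)
    (hN : ∀ t ∈ U, ∀ n, N ≤ n → (P t).coeff n = 0) {ξ : E → ℂ} (hξ : DifferentiableOn ℂ ξ U) :
    DifferentiableOn ℂ (fun t => (P t).eval (ξ t)) U := by
  have h : DifferentiableOn ℂ (fun t => ∑ n ∈ Finset.range N, (P t).coeff n * ξ t ^ n) U :=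
    DifferentiableOn.fun_sum fun n _ => (hP n).mul (hξ.pow n)
  exact h.congr fun t ht => eval_eq_sum_of_coeff_eq_zero (hN t ht) _

/-- A function is annihilated as soon as its derivatives along the generating vector fields of the
trivial deformations vanish. -/
lemma isAnnihilated_of_hasDerivAt {ħ : ℂ} {U : Set (IrregularTimes g)} (hU : IsOpen U)
    {f : IrregularTimes g → ℂ} (hf : DifferentiableOn ℂ f U)
    (hW : ∀ t ∈ U, ∀ k ∈ Finset.Icc 1 (g + 2),
      HasDerivAt (fun r : ℂ => f (t + r • vecW g k)) 0 0)
    (hU₁ : ∀ t ∈ U, HasDerivAt (fun r : ℂ => f (t + r • vecU (-1) t)) 0 0)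
    (hU₀ : ∀ t ∈ U, HasDerivAt (fun r : ℂ => f (t + r • vecU 0 t)) 0 0) :
    IsAnnihilated ħ U f := by
  intro t ht
  have hd := (hf.differentiableAt (hU.mem_nhds ht)).hasFDerivAt
  simp only [deformation_eq]
  refine ⟨fun k hk => ?_, ?_, ?_⟩
  · rw [(hd.hasLineDerivAt _).unique (hW t ht k hk), mul_zero]
  · rw [(hd.hasLineDerivAt _).unique (hU₁ t ht), mul_zero]
  · rw [(hd.hasLineDerivAt _).unique (hU₀ t ht), mul_zero]

section Shifted

variable {ħ : ℂ} {U : Set (IrregularTimes g)} {s : IrregularTimes g → ℂ}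
  {L : IrregularTimes g → Matrix (Fin 2) (Fin 2) ℂ[X]}

/-- The inverse `x ↦ (x - T₁) / T₂` of the affine change of the spectral parameter. -/
def unshift (s : IrregularTimes g → ℂ) (x : ℂ) (t : IrregularTimes g) : ℂ :=
  (x - timeT1 s t) / timeT2 s t

lemma IsRootBranch.differentiableOn_unshift (hs : IsRootBranch U s) (x : ℂ) :
    DifferentiableOn ℂ (unshift s x) U :=
  (hs.differentiableOn_timeT1.const_sub x).mul
    (hs.differentiableOn_timeT2.inv fun _ ht => hs.timeT2_ne_zero ht)

lemma IsRootBranch.hasDerivAt_unshift {t v : IrregularTimes g} {a b : ℂ} (hU : IsOpen U)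
    (hs : IsRootBranch U s) (ht : t ∈ U) (hv : IsTrivialDirection t v a b) (x : ℂ) :
    HasDerivAt (fun r : ℂ => unshift s x (t + r • v)) (-a - b * unshift s x t) 0 := by
  have h0 := hs.timeT2_ne_zero ht
  have h := ((hs.hasDerivAt_timeT1 hU ht hv).const_sub x).div (hs.hasDerivAt_timeT2 hU ht hv)
    (by simpa using h0)
  refine h.congr_deriv ?_
  simp only [zero_smul, add_zero, unshift]
  field_simp

/-- A polynomial in the spectral parameter of weight `m` under the affine group, rescaled by
`T₂ ^ m` and expressed in the shifted parameter, is constant along trivial directions. -/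
lemma IsRootBranch.hasDerivAt_shifted {t v : IrregularTimes g} {a b : ℂ} (hU : IsOpen U)
    (hs : IsRootBranch U s) (ht : t ∈ U) (hv : IsTrivialDirection t v a b)
    {P : IrregularTimes g → ℂ[X]} {N : ℕ} (hN : ∀ t ∈ U, ∀ n, N ≤ n → (P t).coeff n = 0) {m : ℤ}
    (hP : HasCoeffDerivAt (fun r => P (t + r • v))
      (C a * derivative (P t) + C b * (X * derivative (P t) - C (m : ℂ) * P t))) (x : ℂ) :
    HasDerivAt (fun r : ℂ => timeT2 s (t + r • v) ^ m *
      (P (t + r • v)).eval (unshift s x (t + r • v))) 0 0 := by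
  have h0 := hs.timeT2_ne_zero ht
  have h1 := hP.eval (ξ := fun r => unshift s x (t + r • v))
    ((eventually_add_smul_mem hU ht v).mono fun r hr => hN _ hr)
    (hs.hasDerivAt_unshift hU ht hv x)
  have h2 : HasDerivAt (fun r : ℂ => timeT2 s (t + r • v) ^ m) (m * b * timeT2 s t ^ m) 0 := by
    have h3 := (hasDerivAt_zpow m (timeT2 s (t + (0 : ℂ) • v)) (Or.inl (by simpa using h0)))
    refine (h3.comp 0 (hs.hasDerivAt_timeT2 hU ht hv)).congr_deriv ?_
    simp only [zero_smul, add_zero]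
    rw [zpow_sub_one₀ h0]
    field_simp
  refine (h2.mul h1).congr_deriv ?_
  simp only [zero_smul, add_zero, eval_add, eval_sub, eval_mul, eval_C, eval_X]
  ring

lemma IsIsomonodromicFamily.isAnnihilated_shifted_zero_one (hħ : ħ ≠ 0) (hU : IsOpen U)
    (hs : IsRootBranch U s) (hL : IsIsomonodromicFamily ħ U L) (x : ℂ) :
    DifferentiableOn ℂ (fun t => timeT2 s t ^ (g : ℤ) * (L t 0 1).eval (unshift s x t)) U ∧
    IsAnnihilated ħ U (fun t => timeT2 s t ^ (g : ℤ) * (L t 0 1).eval (unshift s x t)) := by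
  have hN : ∀ t ∈ U, ∀ n, g + 2 ≤ n → (L t 0 1).coeff n = 0 :=
    fun t ht n hn => (hL.normalized t ht).coeff_eq_zero _ _ hn
  have hd : DifferentiableOn ℂ
      (fun t => timeT2 s t ^ (g : ℤ) * (L t 0 1).eval (unshift s x t)) U :=
    (hs.differentiableOn_timeT2.zpow (Or.inl fun t ht => hs.timeT2_ne_zero ht)).mul
      (differentiableOn_eval (fun n => hL.differentiableOn 0 1 n) hN
        (hs.differentiableOn_unshift x))
  refine ⟨hd, isAnnihilated_of_hasDerivAt hU hd (fun t ht k hk => ?_) (fun t ht => ?_)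
    (fun t ht => ?_)⟩
  · refine hs.hasDerivAt_shifted hU ht (isTrivialDirection_vecW t hk) (P := fun t => L t 0 1)
      hN ?_ x
    simpa using (hL.hasCoeffDerivAt_vecW hħ hU hs.ne_zero ht hk).1
  · refine hs.hasDerivAt_shifted hU ht (isTrivialDirection_vecU_neg_one t) (P := fun t => L t 0 1)
      hN ?_ x
    simpa using (hL.hasCoeffDerivAt_vecU_neg_one hħ hU hs.ne_zero ht).1
  · refine hs.hasDerivAt_shifted hU ht (isTrivialDirection_vecU_zero t) (P := fun t => L t 0 1)
      hN ?_ x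
    simpa using (hL.hasCoeffDerivAt_vecU_zero hħ hU hs.ne_zero ht).1

lemma IsIsomonodromicFamily.isAnnihilated_shifted_diagonal (hħ : ħ ≠ 0) (hU : IsOpen U)
    (hs : IsRootBranch U s) (hL : IsIsomonodromicFamily ħ U L) (x : ℂ) :
    DifferentiableOn ℂ
      (fun t => timeT2 s t ^ (-1 : ℤ) * (L t 0 0 - L t 1 1).eval (unshift s x t)) U ∧
    IsAnnihilated ħ U
      (fun t => timeT2 s t ^ (-1 : ℤ) * (L t 0 0 - L t 1 1).eval (unshift s x t)) := by
  have hN : ∀ t ∈ U, ∀ n, g ≤ n → (L t 0 0 - L t 1 1).coeff n = 0 :=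
    fun t ht n hn => (hL.normalized t ht).coeff_sub hn
  have hd : DifferentiableOn ℂ
      (fun t => timeT2 s t ^ (-1 : ℤ) * (L t 0 0 - L t 1 1).eval (unshift s x t)) U :=
    (hs.differentiableOn_timeT2.zpow (Or.inl fun t ht => hs.timeT2_ne_zero ht)).mul
      (differentiableOn_eval (fun n => by
        simpa only [coeff_sub] using
          (hL.differentiableOn 0 0 n).fun_sub (hL.differentiableOn 1 1 n))
        hN (hs.differentiableOn_unshift x))
  refine ⟨hd, isAnnihilated_of_hasDerivAt hU hd (fun t ht k hk => ?_) (fun t ht => ?_)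
    (fun t ht => ?_)⟩
  · refine hs.hasDerivAt_shifted hU ht (isTrivialDirection_vecW t hk)
      (P := fun t => L t 0 0 - L t 1 1) hN ?_ x
    simpa using (hL.hasCoeffDerivAt_vecW hħ hU hs.ne_zero ht hk).2
  · refine hs.hasDerivAt_shifted hU ht (isTrivialDirection_vecU_neg_one t)
      (P := fun t => L t 0 0 - L t 1 1) hN ?_ x
    simpa [sub_eq_add_neg, add_comm] using (hL.hasCoeffDerivAt_vecU_neg_one hħ hU hs.ne_zero ht).2
  · refine hs.hasDerivAt_shifted hU ht (isTrivialDirection_vecU_zero t)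
      (P := fun t => L t 0 0 - L t 1 1) hN ?_ x
    simpa using (hL.hasCoeffDerivAt_vecU_zero hħ hU hs.ne_zero ht).2

end Shifted

end

/-! ### Translation of the odd times -/

section

/-- The rising product `(j + 1/2) (j + 3/2) ⋯ (j + i - 1/2)`. -/
def halfRising (j i : ℕ) : ℂ := ∏ l ∈ Finset.range i, ((j : ℂ) + l + 1 / 2)

lemma halfRising_add (j i l : ℕ) :
    halfRising j (i + l) = halfRising j i * halfRising (j + i) l := by
  rw [halfRising, Finset.prod_range_add]
  congr 1
  refine Finset.prod_congr rfl fun m _ => ?_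
  push_cast
  ring

lemma halfRising_one_add (j i : ℕ) :
    halfRising j (1 + i) = ((j : ℂ) + 1 / 2) * halfRising (j + 1) i := by
  rw [halfRising_add]
  simp [halfRising]

/-- The effect of the translation `λ ↦ λ + T` on the odd times: if
`F = ∑ 2 o_j / (2 j + 1) λ ^ (j + 1/2)`, this sequence gives in the same way the terms of positive
degree of `F (λ + T)`. The sequence `o` is supposed to vanish from the index `N` on. -/
def translateSeq (N : ℕ) (T : ℂ) (o : ℕ → ℂ) (j : ℕ) : ℂ :=
  ∑ i ∈ Finset.range N, halfRising j i / (i.factorial : ℂ) * T ^ i * o (j + i)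

lemma translateSeq_eq_zero {N : ℕ} {T : ℂ} {o : ℕ → ℂ} (ho : ∀ j, N ≤ j → o j = 0) {j : ℕ}
    (hj : N ≤ j) : translateSeq N T o j = 0 :=
  Finset.sum_eq_zero fun i _ => by rw [ho _ (by omega), mul_zero]

lemma translateSeq_neg_translateSeq {N : ℕ} (T : ℂ) {o : ℕ → ℂ} (ho : ∀ j, N ≤ j → o j = 0)
    (j : ℕ) : translateSeq N (-T) (translateSeq N T o) j = o j := by
  rcases Nat.lt_or_ge j N with hj | hj
  swap
  · rw [translateSeq_eq_zero (fun j hj => translateSeq_eq_zero ho hj) hj, ho j hj]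
  set F : ℕ → ℕ → ℂ := fun i l => halfRising j (i + l) * o (j + (i + l)) *
    ((-T) ^ i * T ^ l / ((i.factorial : ℂ) * (l.factorial : ℂ))) with hF
  have h1 : translateSeq N (-T) (translateSeq N T o) j =
      ∑ i ∈ Finset.range N, ∑ l ∈ Finset.range (N - i), F i l := by
    refine Finset.sum_congr rfl fun i hi => ?_
    rw [translateSeq, Finset.mul_sum]
    have hsub : Finset.range (N - i) ⊆ Finset.range N :=
      Finset.range_subset_range.mpr (Nat.sub_le _ _)
    rw [← Finset.sum_subset hsub fun l _ hl => ?_]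
    · refine Finset.sum_congr rfl fun l _ => ?_
      simp only [hF]
      rw [halfRising_add, add_assoc]
      field_simp
    · rw [Finset.mem_range] at hl
      rw [ho _ (by omega), mul_zero, mul_zero]
  rw [h1, ← Finset.sum_range_diag_flip]
  have h2 : ∀ m ∈ Finset.range N, ∑ k ∈ Finset.range (m + 1), F k (m - k) =
      if m = 0 then o j else 0 := by
    intro m _
    have h3 : ∑ k ∈ Finset.range (m + 1), F k (m - k) =
        halfRising j m * o (j + m) / (m.factorial : ℂ) * (-T + T) ^ m := by
      rw [add_pow, Finset.mul_sum]
      refine Finset.sum_congr rfl fun k hk => ?_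
      have hk' : k ≤ m := Nat.lt_succ_iff.mp (Finset.mem_range.mp hk)
      have hm0 : (m.factorial : ℂ) ≠ 0 := Nat.cast_ne_zero.mpr m.factorial_ne_zero
      simp only [hF]
      rw [Nat.add_sub_cancel' hk', Nat.cast_choose ℂ hk']
      field_simp
    rw [h3, neg_add_cancel]
    split_ifs with hm
    · subst hm
      simp [halfRising]
    · rw [zero_pow hm, mul_zero]
  rw [Finset.sum_congr rfl h2, Finset.sum_ite_eq' (Finset.range N) 0,
    if_pos (Finset.mem_range.mpr (by omega))]

lemma hasDerivAt_translateSeq {N : ℕ} {o : ℕ → ℂ} (ho : ∀ j, N ≤ j → o j = 0) (T : ℂ) (j : ℕ) :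
    HasDerivAt (fun T => translateSeq N T o j)
      (((j : ℂ) + 1 / 2) * translateSeq N T o (j + 1)) T := by
  rcases N with _ | N
  · simpa [translateSeq] using hasDerivAt_const T (0 : ℂ)
  have h : HasDerivAt (fun T => translateSeq (N + 1) T o j)
      (∑ i ∈ Finset.range (N + 1),
        halfRising j i / (i.factorial : ℂ) * (i * T ^ (i - 1)) * o (j + i)) T :=
    HasDerivAt.fun_sum fun i _ => ((hasDerivAt_pow i T).const_mul _).mul_const _
  refine h.congr_deriv ?_
  rw [Finset.sum_range_succ', translateSeq, Finset.sum_range_succ, ho (j + 1 + N) (by omega),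
    Nat.cast_zero, zero_mul, mul_zero, zero_mul, add_zero, mul_zero, add_zero, Finset.mul_sum]
  refine Finset.sum_congr rfl fun i _ => ?_
  have hi : ((i.factorial : ℂ)) ≠ 0 := Nat.cast_ne_zero.mpr i.factorial_ne_zero
  have hi' : ((i + 1 : ℕ) : ℂ) ≠ 0 := Nat.cast_ne_zero.mpr (by omega)
  rw [add_comm i 1, halfRising_one_add, add_comm 1 i, Nat.factorial_succ, Nat.cast_mul,
    Nat.add_sub_cancel, show j + 1 + i = j + (i + 1) by ring]
  field_simp

variable {g : ℕ}

/-- The normalized odd times `t_{2g+3} = 2`, `t_{2g+1} = 0`, `t_{2g+1-2k} = 2 τ_k`, as a sequence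
`j ↦ t_{2j+1}`. -/
def normalizedSeq (c : Fin g → ℂ) (j : ℕ) : ℂ :=
  if j = g + 1 then 2 else if h : j < g then 2 * c ⟨g - 1 - j, by omega⟩ else 0

lemma normalizedSeq_of_le (c : Fin g → ℂ) {j : ℕ} (hj : g + 2 ≤ j) : normalizedSeq c j = 0 := by
  rw [normalizedSeq, if_neg (by omega), dif_neg (by omega)]

lemma normalizedSeq_top (c : Fin g → ℂ) : normalizedSeq c (g + 1) = 2 := if_pos rfl

lemma normalizedSeq_self (c : Fin g → ℂ) : normalizedSeq c g = 0 := by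
  rw [normalizedSeq, if_neg (by omega), dif_neg (by omega)]

lemma translateSeq_top (T : ℂ) {o : ℕ → ℂ} (ho : ∀ j, g + 2 ≤ j → o j = 0) :
    translateSeq (g + 2) T o (g + 1) = o (g + 1) := by
  rw [translateSeq, Finset.sum_range_succ', Finset.sum_eq_zero fun i _ => by
    rw [ho _ (by omega), mul_zero]]
  simp [halfRising]

lemma translateSeq_self (T : ℂ) {o : ℕ → ℂ} (ho : ∀ j, g + 2 ≤ j → o j = 0) :
    translateSeq (g + 2) T o g = o g + (2 * (g : ℂ) + 1) / 2 * T * o (g + 1) := by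
  rw [translateSeq, Finset.sum_range_succ', Finset.sum_range_succ', Finset.sum_eq_zero fun i _ => by
    rw [ho _ (by omega), mul_zero]]
  simp [halfRising]
  ring

/-! ### The coordinates formed by all times and their inverse -/

/-- Values of the new times: the even times, `T₁` and `s = T₂ ^ (1/2)`, and the isomonodromic
times. -/
abbrev TimeCoordinates (g : ℕ) : Type := ((Fin (g + 2) → ℂ) × ℂ × ℂ) × (Fin g → ℂ)

/-- The irregular times as polynomials in the new times: the normalized odd times are translated by
`T₁` and rescaled by `s`. -/
def timesOf (x : TimeCoordinates g) : IrregularTimes g := fun i =>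
  if i.val % 2 = 0 then
    x.1.2.2 ^ (i.val + 1) * translateSeq (g + 2) x.1.2.1 (normalizedSeq x.2) (i.val / 2)
  else x.1.1 ⟨i.val / 2, by omega⟩

/-- The new times of a point. -/
def coordsOf (s : IrregularTimes g → ℂ) (t : IrregularTimes g) : TimeCoordinates g :=
  ((fun k => irregTime t (2 * k.val + 2), timeT1 s t, s t), isoTimes s t)

lemma irregTimes_ext {t t' : IrregularTimes g}
    (hodd : ∀ j, irregTime t (2 * j + 1) = irregTime t' (2 * j + 1))
    (heven : ∀ k : Fin (g + 2), irregTime t (2 * k.val + 2) = irregTime t' (2 * k.val + 2)) :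
    t = t' := by
  ext i
  have key : ∀ t : IrregularTimes g, irregTime t (i.val + 1) = t i := fun t => by
    rw [irregTime, dif_pos (by omega)]
    rfl
  rw [← key t, ← key t']
  rcases Nat.even_or_odd' i.val with ⟨j, hj | hj⟩
  · rw [hj]
    exact hodd j
  · rw [hj]
    exact heven ⟨j, by omega⟩

lemma irregTime_timesOf_odd (x : TimeCoordinates g) (j : ℕ) :
    irregTime (timesOf x) (2 * j + 1) =
      x.1.2.2 ^ (2 * j + 1) * translateSeq (g + 2) x.1.2.1 (normalizedSeq x.2) j := by
  by_cases hj : j < g + 2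
  · rw [irregTime, dif_pos (by omega), timesOf]
    simp only [Nat.add_sub_cancel]
    rw [if_pos (by omega), show 2 * j / 2 = j by omega]
  · rw [irregTime_of_lt _ (by omega),
      translateSeq_eq_zero (fun j hj => normalizedSeq_of_le _ hj) (by omega), mul_zero]

lemma irregTime_timesOf_even (x : TimeCoordinates g) (k : Fin (g + 2)) :
    irregTime (timesOf x) (2 * k.val + 2) = x.1.1 k := by
  rw [irregTime, dif_pos (by omega), timesOf]
  simp only [show 2 * k.val + 2 - 1 = 2 * k.val + 1 by omega]
  rw [if_neg (by omega)]
  exact congrArg _ (Fin.ext (by simp only; omega))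

lemma irregTime_timesOf_top (x : TimeCoordinates g) :
    irregTime (timesOf x) (2 * g + 3) / 2 = x.1.2.2 ^ (2 * g + 3) := by
  have h := irregTime_timesOf_odd x (g + 1)
  rw [translateSeq_top _ fun j hj => normalizedSeq_of_le _ hj, normalizedSeq_top] at h
  rw [show 2 * g + 3 = 2 * (g + 1) + 1 by ring, h]
  ring

/-- The odd times rescaled by powers of the root `s`. -/
def rescaledSeq (s : IrregularTimes g → ℂ) (t : IrregularTimes g) (j : ℕ) : ℂ :=
  (s t ^ (2 * j + 1))⁻¹ * irregTime t (2 * j + 1)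

lemma rescaledSeq_of_le (s : IrregularTimes g → ℂ) (t : IrregularTimes g) {j : ℕ}
    (hj : g + 2 ≤ j) : rescaledSeq s t j = 0 := by
  rw [rescaledSeq, irregTime_of_lt t (by omega), mul_zero]

lemma two_mul_add_one_ne_zero (g : ℕ) : 2 * (g : ℂ) + 1 ≠ 0 := by
  exact_mod_cast (by omega : 2 * g + 1 ≠ 0)

lemma rescaledSeq_self (s : IrregularTimes g → ℂ) (t : IrregularTimes g) :
    rescaledSeq s t g = (2 * (g : ℂ) + 1) * timeT1 s t := by
  have := two_mul_add_one_ne_zero g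
  rw [rescaledSeq, timeT1]
  field_simp

/-- The isomonodromic times are the odd times, rescaled and translated so that `t_{2g+3} = 2` and
`t_{2g+1} = 0`. -/
lemma isoTimeAux_eq {s : IrregularTimes g → ℂ} {t : IrregularTimes g} (h0 : s t ≠ 0)
    (hpow : s t ^ (2 * g + 3) = irregTime t (2 * g + 3) / 2) {k : ℕ} (hk : 1 ≤ k) (hkg : k ≤ g) :
    2 * isoTimeAux s k t = translateSeq (g + 2) (-timeT1 s t) (rescaledSeq s t) (g - k) := by
  set T := timeT1 s t with hT
  set σ := s t with hσ
  have hG := two_mul_add_one_ne_zero g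
  set G : ℂ := 2 * (g : ℂ) + 1 with hGdef
  have ht1 : irregTime t (2 * g + 1) / 2 = G * T * σ ^ (2 * g + 1) / 2 := by
    rw [hT, timeT1, ← hσ, ← hGdef]
    field_simp
  have hprod : ∀ i : ℕ, ∏ m ∈ Finset.Icc 1 i, (2 * (g : ℂ) - 2 * k + 2 * (m : ℂ) - 1) =
      2 ^ i * halfRising (g - k) i := fun i => by
    induction i with
    | zero => simp [halfRising]
    | succ i ih =>
      rw [Finset.prod_Icc_succ_top (by omega), ih, halfRising, halfRising, Finset.prod_range_succ,
        Nat.cast_sub hkg]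
      push_cast
      ring
  have hr : rescaledSeq s t g = G * T := rescaledSeq_self s t
  have hr' : rescaledSeq s t (g + 1) = 2 := by
    rw [rescaledSeq, show 2 * (g + 1) + 1 = 2 * g + 3 by ring, inv_mul_eq_iff_eq_mul₀
      (pow_ne_zero _ h0), hpow]
    ring
  have hsub : Finset.range (k + 2) ⊆ Finset.range (g + 2) :=
    Finset.range_subset_range.mpr (by omega)
  rw [translateSeq, ← Finset.sum_subset hsub fun i _ hi => ?_]
  swap
  · rw [Finset.mem_range] at hi
    rw [rescaledSeq_of_le _ _ (by omega), mul_zero]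
  rw [Finset.sum_range_succ, Finset.sum_range_succ, isoTimeAux, ← hσ, ← hGdef, mul_add,
    Finset.mul_sum, add_assoc]
  congr 1
  · refine Finset.sum_congr rfl fun i hi => ?_
    have hi' := Finset.mem_range.mp hi
    rw [hprod, ht1, rescaledSeq, show 2 * g + 1 - 2 * k + 2 * i = 2 * (g - k + i) + 1 by omega,
      show (2 * g + 3) * i + (2 * g + 1 - 2 * k) = (2 * g + 1) * i + (2 * (g - k + i) + 1) by
        rw [add_mul, add_mul]; omega, pow_add σ ((2 * g + 1) * i), div_pow,
      mul_pow, mul_pow, ← pow_mul, neg_pow T]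
    have h1 : σ ^ ((2 * g + 1) * i) ≠ 0 := pow_ne_zero _ h0
    have h2 : σ ^ (2 * (g - k + i) + 1) ≠ 0 := pow_ne_zero _ h0
    have h3 : ((i.factorial : ℂ)) ≠ 0 := Nat.cast_ne_zero.mpr i.factorial_ne_zero
    have h4 : G ^ i ≠ 0 := pow_ne_zero _ hG
    rw [← hσ]
    field_simp
  · rw [hprod, ht1, show g - k + k = g by omega, show g - k + (k + 1) = g + 1 by omega, hr, hr',
      halfRising_add]
    have h1 : halfRising (g - k + k) 1 = G / 2 := by
      rw [show g - k + k = g by omega, hGdef]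
      simp [halfRising]
      ring
    have h2 : (k.factorial : ℂ) = k * ((k - 1).factorial : ℂ) := by
      rw [← Nat.cast_mul, Nat.mul_factorial_pred (by omega)]
    have h3 : ((k + 1).factorial : ℂ) = (k + 1) * (k * ((k - 1).factorial : ℂ)) := by
      rw [Nat.factorial_succ, Nat.cast_mul, h2]
      push_cast
      ring
    have hk0 : (k : ℂ) ≠ 0 := Nat.cast_ne_zero.mpr (by omega)
    have hk1 : (k : ℂ) + 1 ≠ 0 := by exact_mod_cast (by omega : k + 1 ≠ 0)
    have hf : ((k - 1).factorial : ℂ) ≠ 0 := Nat.cast_ne_zero.mpr (Nat.factorial_ne_zero _)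
    have h4 : G ^ k ≠ 0 := pow_ne_zero _ hG
    have h5 : σ ^ ((k + 1) * (2 * g + 1)) ≠ 0 := pow_ne_zero _ h0
    rw [h1, h2, h3, div_pow, mul_pow, mul_pow, ← pow_mul, mul_comm (2 * g + 1), pow_succ G,
      pow_succ 2, pow_succ T, pow_succ (-T), neg_pow T]
    field_simp
    ring

section Branch

variable {s : IrregularTimes g → ℂ} {t : IrregularTimes g}

lemma rescaledSeq_top (h0 : s t ≠ 0)
    (hpow : s t ^ (2 * g + 3) = irregTime t (2 * g + 3) / 2) : rescaledSeq s t (g + 1) = 2 := by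
  rw [rescaledSeq, show 2 * (g + 1) + 1 = 2 * g + 3 by ring, inv_mul_eq_iff_eq_mul₀
    (pow_ne_zero _ h0), hpow]
  ring

lemma translateSeq_rescaledSeq (h0 : s t ≠ 0)
    (hpow : s t ^ (2 * g + 3) = irregTime t (2 * g + 3) / 2) (j : ℕ) :
    translateSeq (g + 2) (-timeT1 s t) (rescaledSeq s t) j = normalizedSeq (isoTimes s t) j := by
  have hz : ∀ j, g + 2 ≤ j → rescaledSeq s t j = 0 := fun j hj => rescaledSeq_of_le s t hj
  rcases Nat.lt_trichotomy j g with h | rfl | h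
  · rw [normalizedSeq, if_neg (by omega), dif_pos h, isoTimes]
    simp only
    rw [show g - 1 - j + 1 = g - j by omega, isoTimeAux_eq h0 hpow (by omega) (by omega),
      show g - (g - j) = j by omega]
  · rw [normalizedSeq_self, translateSeq_self _ hz, rescaledSeq_self, rescaledSeq_top h0 hpow]
    ring
  · rcases (show g + 1 ≤ j from h).eq_or_lt with rfl | h
    · rw [normalizedSeq_top, translateSeq_top _ hz, rescaledSeq_top h0 hpow]
    · rw [normalizedSeq_of_le _ h, translateSeq_eq_zero hz h]

lemma timesOf_coordsOf (h0 : s t ≠ 0)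
    (hpow : s t ^ (2 * g + 3) = irregTime t (2 * g + 3) / 2) : timesOf (coordsOf s t) = t := by
  refine irregTimes_ext (fun j => ?_) (fun k => irregTime_timesOf_even _ k)
  rw [irregTime_timesOf_odd]
  have h : normalizedSeq (coordsOf s t).2 =
      translateSeq (g + 2) (-timeT1 s t) (rescaledSeq s t) :=
    (funext (translateSeq_rescaledSeq h0 hpow)).symm
  have h2 := translateSeq_neg_translateSeq (-timeT1 s t)
    (fun j hj => rescaledSeq_of_le s t hj) j
  rw [neg_neg] at h2
  rw [h]
  simp only [coordsOf]
  rw [h2, rescaledSeq, mul_inv_cancel_left₀ (pow_ne_zero _ h0)]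

lemma normalizedSeq_injective : Function.Injective (normalizedSeq (g := g)) := fun c c' h => by
  ext k
  have h1 := congrFun h (g - 1 - k.val)
  simp only [normalizedSeq] at h1
  rw [if_neg (by omega), dif_pos (by omega), if_neg (by omega), dif_pos (by omega)] at h1
  have h2 : (⟨g - 1 - (g - 1 - k.val), by omega⟩ : Fin g) = k := by
    ext
    simp only
    omega
  rw [h2] at h1
  exact mul_left_cancel₀ two_ne_zero h1

lemma coordsOf_timesOf {x : TimeCoordinates g} (h0 : x.1.2.2 ≠ 0) (hs : s (timesOf x) = x.1.2.2) :
    coordsOf s (timesOf x) = x := by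
  have hpow : s (timesOf x) ^ (2 * g + 3) = irregTime (timesOf x) (2 * g + 3) / 2 := by
    rw [hs, irregTime_timesOf_top]
  have h0' : s (timesOf x) ≠ 0 := by rwa [hs]
  have hn : ∀ j, g + 2 ≤ j → normalizedSeq x.2 j = 0 := fun j hj => normalizedSeq_of_le _ hj
  have hr : rescaledSeq s (timesOf x) = translateSeq (g + 2) x.1.2.1 (normalizedSeq x.2) := by
    ext j
    rw [rescaledSeq, irregTime_timesOf_odd, hs, inv_mul_cancel_left₀ (pow_ne_zero _ h0)]
  have hT : timeT1 s (timesOf x) = x.1.2.1 := by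
    have h1 := rescaledSeq_self s (timesOf x)
    rw [hr, translateSeq_self _ hn, normalizedSeq_self, normalizedSeq_top] at h1
    refine mul_left_cancel₀ (two_mul_add_one_ne_zero g) (h1.symm.trans ?_)
    ring
  have hc : isoTimes s (timesOf x) = x.2 := by
    refine normalizedSeq_injective (funext fun j => ?_)
    rw [← translateSeq_rescaledSeq h0' hpow, hr, hT, translateSeq_neg_translateSeq _ hn]
  refine Prod.ext (Prod.ext (funext fun k => irregTime_timesOf_even x k) (Prod.ext hT hs)) hc

end Branch

end

/-! ### Differentiability of the coordinates -/

section

variable {g : ℕ}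

lemma differentiableOn_translateSeq {E : Type*} [NormedAddCommGroup E] [NormedSpace ℂ E]
    {U : Set E} {N : ℕ} {T : E → ℂ} {o : E → ℕ → ℂ} (hT : DifferentiableOn ℂ T U)
    (ho : ∀ j, DifferentiableOn ℂ (fun x => o x j) U) (j : ℕ) :
    DifferentiableOn ℂ (fun x => translateSeq N (T x) (o x) j) U :=
  DifferentiableOn.fun_sum fun i _ => ((hT.pow i).const_mul _).mul (ho (j + i))

lemma differentiable_normalizedSeq (j : ℕ) :
    Differentiable ℂ fun c : Fin g → ℂ => normalizedSeq c j := by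
  unfold normalizedSeq
  split_ifs <;> fun_prop

lemma differentiable_timesOf : Differentiable ℂ (timesOf (g := g)) := by
  refine differentiable_pi.mpr fun i => ?_
  unfold timesOf
  split_ifs
  · rw [← differentiableOn_univ]
    have h : DifferentiableOn ℂ (fun x : TimeCoordinates g =>
        translateSeq (g + 2) x.1.2.1 (normalizedSeq x.2) (i.val / 2)) Set.univ := by
      refine differentiableOn_translateSeq (by fun_prop) (fun j => ?_) _
      exact ((differentiable_normalizedSeq j).comp differentiable_snd).differentiableOn
    fun_prop
  · fun_prop

lemma hasDerivAt_irregTime_comp {γ : ℂ → IrregularTimes g} {γ' : IrregularTimes g} {r : ℂ}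
    (h : HasDerivAt γ γ' r) (k : ℕ) :
    HasDerivAt (fun r => irregTime (γ r) k) (irregTime γ' k) r := by
  unfold irregTime
  split_ifs
  · exact hasDerivAt_pi.mp h _
  · exact hasDerivAt_const _ _

section Branch

variable {U : Set (IrregularTimes g)} {s : IrregularTimes g → ℂ}

lemma IsRootBranch.differentiableOn_rescaledSeq (hs : IsRootBranch U s) (j : ℕ) :
    DifferentiableOn ℂ (fun t => rescaledSeq s t j) U :=
  ((hs.differentiableOn.pow _).inv fun _ ht => pow_ne_zero _ (hs.s_ne_zero ht)).mul
    (differentiable_irregTime _).differentiableOn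

lemma IsRootBranch.differentiableOn_isoTimes (hs : IsRootBranch U s) :
    DifferentiableOn ℂ (isoTimes s) U := by
  refine differentiableOn_pi.mpr fun k => ?_
  have h := (differentiableOn_translateSeq (N := g + 2) hs.differentiableOn_timeT1.neg
    hs.differentiableOn_rescaledSeq (g - (k.val + 1))).const_mul (1 / 2)
  refine h.congr fun t ht => ?_
  have h1 := isoTimeAux_eq (hs.s_ne_zero ht) (hs.pow_eq t ht) (k := k.val + 1) (by omega) (by omega)
  change isoTimeAux s (k.val + 1) t = 1 / 2 * translateSeq (g + 2) (-timeT1 s t) (rescaledSeq s t) _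
  rw [← h1]
  ring

lemma IsRootBranch.differentiableOn_coordsOf (hs : IsRootBranch U s) :
    DifferentiableOn ℂ (coordsOf s) U := by
  have h : DifferentiableOn ℂ
      (fun t : IrregularTimes g => fun k : Fin (g + 2) => irregTime t (2 * k.val + 2)) U :=
    differentiableOn_pi.mpr fun k => (differentiable_irregTime _).differentiableOn
  exact (h.prodMk (hs.differentiableOn_timeT1.prodMk hs.differentiableOn)).prodMk
    hs.differentiableOn_isoTimes

lemma IsRootBranch.timesOf_coordsOf (hs : IsRootBranch U s) {t : IrregularTimes g} (ht : t ∈ U) :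
    timesOf (coordsOf s t) = t :=
  TwistedIsomonodromy.timesOf_coordsOf (hs.s_ne_zero ht) (hs.pow_eq t ht)

lemma eventually_eq_one_of_pow_eq_one {n : ℕ} (hn : 0 < n) :
    ∀ᶠ z : ℂ in 𝓝 1, z ^ n = 1 → z = 1 := by
  have hfin : ({z : ℂ | z ^ n = 1 ∧ z ≠ 1} : Set ℂ).Finite := by
    refine ((Polynomial.nthRootsFinset n (1 : ℂ)).finite_toSet).subset fun z hz => ?_
    rw [Finset.mem_coe, Polynomial.mem_nthRootsFinset hn]
    exact hz.1
  filter_upwards [hfin.isClosed.isOpen_compl.mem_nhds (x := 1) (by simp)] with z hz h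
  by_contra h1
  exact hz ⟨h, h1⟩

/-- Near the coordinates of a point of `U`, the polynomial map `timesOf` takes values in `U` and is
compatible with the branch `s`: the quotient `s / σ` is a root of unity close to `1`. -/
lemma IsRootBranch.eventually_timesOf (hU : IsOpen U) (hs : IsRootBranch U s)
    {t₀ : IrregularTimes g} (ht₀ : t₀ ∈ U) :
    ∀ᶠ x in 𝓝 (coordsOf s t₀), timesOf x ∈ U ∧ s (timesOf x) = x.1.2.2 := by
  set x₀ := coordsOf s t₀ with hx₀
  have hx : timesOf x₀ = t₀ := hs.timesOf_coordsOf ht₀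
  have hcont : ContinuousAt timesOf x₀ := differentiable_timesOf.continuous.continuousAt
  have hmem : ∀ᶠ x in 𝓝 x₀, timesOf x ∈ U :=
    hcont.eventually_mem (hU.mem_nhds (by rwa [hx]))
  have hσ : ContinuousAt (fun x : TimeCoordinates g => x.1.2.2) x₀ := by fun_prop
  have h0 : x₀.1.2.2 ≠ 0 := hs.s_ne_zero ht₀
  have hsc : ContinuousAt s (timesOf x₀) := by
    rw [hx]
    exact (hs.differentiableOn.continuousOn).continuousAt (hU.mem_nhds ht₀)
  have hq : ContinuousAt (fun x => s (timesOf x) / x.1.2.2) x₀ :=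
    (ContinuousAt.comp (f := timesOf) hsc hcont).div hσ h0
  have hq1 : s (timesOf x₀) / x₀.1.2.2 = 1 := by
    rw [hx]
    exact div_self h0
  have hroot : ∀ᶠ x in 𝓝 x₀, (s (timesOf x) / x.1.2.2) ^ (2 * g + 3) = 1 →
      s (timesOf x) / x.1.2.2 = 1 := by
    refine hq.eventually (p := fun z => z ^ (2 * g + 3) = 1 → z = 1) ?_
    simp only [hq1]
    exact eventually_eq_one_of_pow_eq_one (by omega)
  filter_upwards [hmem, hroot, hσ.eventually_ne h0] with x h1 h2 h3
  refine ⟨h1, (div_eq_one_iff_eq h3).mp (h2 ?_)⟩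
  rw [div_pow, hs.pow_eq _ h1, irregTime_timesOf_top, div_self (pow_ne_zero _ h3)]

lemma IsRootBranch.eventually_coordsOf_timesOf (hU : IsOpen U) (hs : IsRootBranch U s)
    {t₀ : IrregularTimes g} (ht₀ : t₀ ∈ U) :
    ∀ᶠ x in 𝓝 (coordsOf s t₀), coordsOf s (timesOf x) = x := by
  filter_upwards [hs.eventually_timesOf hU ht₀] with x hx
  exact coordsOf_timesOf (by rw [← hx.2]; exact hs.s_ne_zero hx.1) hx.2

end Branch

/-! ### Trivial directions in the new coordinates -/

lemma isTrivialDirection_fderiv_timesOf {x : TimeCoordinates g} (h0 : x.1.2.2 ≠ 0)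
    (y : (Fin (g + 2) → ℂ) × ℂ × ℂ) :
    IsTrivialDirection (timesOf x) (fderiv ℂ timesOf x (y, 0)) (y.2.1 / x.1.2.2 ^ 2)
      (2 * y.2.2 / x.1.2.2) := by
  intro j
  have h1 := hasDerivAt_irregTime_comp
    ((differentiable_timesOf x).hasFDerivAt.hasLineDerivAt (y, (0 : Fin g → ℂ))) (2 * j + 1)
  have hT : HasDerivAt (fun r : ℂ => x.1.2.1 + r * y.2.1) y.2.1 0 := by
    simpa using ((hasDerivAt_id (0 : ℂ)).mul_const y.2.1).const_add x.1.2.1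
  have hσ : HasDerivAt (fun r : ℂ => x.1.2.2 + r * y.2.2) y.2.2 0 := by
    simpa using ((hasDerivAt_id (0 : ℂ)).mul_const y.2.2).const_add x.1.2.2
  have htr : HasDerivAt (fun r : ℂ => translateSeq (g + 2) (x.1.2.1 + r * y.2.1)
      (normalizedSeq x.2) j) (((j : ℂ) + 1 / 2) * translateSeq (g + 2) x.1.2.1
      (normalizedSeq x.2) (j + 1) * y.2.1) 0 := by
    have h := hasDerivAt_translateSeq (N := g + 2)
      (fun j hj => normalizedSeq_of_le x.2 hj) (x.1.2.1 + 0 * y.2.1) j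
    refine (HasDerivAt.comp (0 : ℂ) h hT).congr_deriv ?_
    rw [zero_mul, add_zero]
  have h2 := (HasDerivAt.pow hσ (2 * j + 1)).mul htr
  have h3 := h1.unique (h2.congr_of_eventuallyEq (Filter.Eventually.of_forall fun r => by
    simp only [irregTime_timesOf_odd]
    simp))
  rw [h3, show 2 * j + 3 = 2 * (j + 1) + 1 by ring, irregTime_timesOf_odd, irregTime_timesOf_odd]
  simp only [Pi.pow_apply, zero_mul, add_zero, Nat.add_sub_cancel]
  push_cast
  rw [show 2 * (j + 1) + 1 = 2 * j + 1 + 2 by ring, pow_add _ _ 2, pow_succ _ (2 * j)]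
  field_simp
  ring

lemma irregTime_fderiv_timesOf_even (x : TimeCoordinates g) (y : (Fin (g + 2) → ℂ) × ℂ × ℂ)
    (k : Fin (g + 2)) : irregTime (fderiv ℂ timesOf x (y, 0)) (2 * k.val + 2) = y.1 k := by
  have h1 := hasDerivAt_irregTime_comp
    ((differentiable_timesOf x).hasFDerivAt.hasLineDerivAt (y, (0 : Fin g → ℂ))) (2 * k.val + 2)
  have h2 : HasDerivAt (fun r : ℂ => x.1.1 k + r * y.1 k) (y.1 k) 0 := by
    simpa using ((hasDerivAt_id (0 : ℂ)).mul_const (y.1 k)).const_add (x.1.1 k)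
  refine h1.unique (h2.congr_of_eventuallyEq (Filter.Eventually.of_forall fun r => ?_))
  simp only [irregTime_timesOf_even]
  simp

lemma IsTrivialDirection.exists_fderiv_timesOf {x : TimeCoordinates g} (h0 : x.1.2.2 ≠ 0)
    {v : IrregularTimes g} {a b : ℂ} (hv : IsTrivialDirection (timesOf x) v a b) :
    ∃ y, fderiv ℂ timesOf x (y, 0) = v := by
  refine ⟨(fun k => irregTime v (2 * k.val + 2), a * x.1.2.2 ^ 2, b / 2 * x.1.2.2), ?_⟩
  refine irregTimes_ext (fun j => ?_) fun k => irregTime_fderiv_timesOf_even _ _ _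
  rw [hv j, isTrivialDirection_fderiv_timesOf h0 _ j]
  field_simp

lemma apply_eq_zero_of_odd_eq_zero {φ : IrregularTimes g →L[ℂ] ℂ}
    (hφ : ∀ k ∈ Finset.Icc 1 (g + 2), φ (vecW g k) = 0) {v : IrregularTimes g}
    (hv : ∀ j, irregTime v (2 * j + 1) = 0) : φ v = 0 := by
  rw [apply_eq_sum_single]
  refine Finset.sum_eq_zero fun i _ => ?_
  rcases Nat.even_or_odd' i.val with ⟨j, hj | hj⟩
  · have := hv j
    rw [irregTime, dif_pos (by omega)] at this
    rw [show i = ⟨2 * j + 1 - 1, by omega⟩ from Fin.ext (by simp only; omega), this, zero_mul]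
  · have h : (Pi.single i 1 : IrregularTimes g) = vecW g (j + 1) := by
      ext l
      rw [vecW, Pi.single_apply]
      congr 1
      rw [Fin.ext_iff]
      simp only [eq_iff_iff]
      omega
    rw [h, hφ _ (Finset.mem_Icc.mpr (by omega)), mul_zero]

lemma irregTime_sub_smul_sub_smul (v u u' : IrregularTimes g) (a b : ℂ) (k : ℕ) :
    irregTime (v - a • u - b • u') k = irregTime v k - a * irregTime u k - b * irregTime u' k := by
  unfold irregTime
  split_ifs <;> simp

lemma isAnnihilated_iff {ħ : ℂ} (hħ : ħ ≠ 0) {U : Set (IrregularTimes g)}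
    {f : IrregularTimes g → ℂ} :
    IsAnnihilated ħ U f ↔
      ∀ t ∈ U, ∀ v a b, IsTrivialDirection t v a b → fderiv ℂ f t v = 0 := by
  simp only [IsAnnihilated, deformation_eq, mul_eq_zero, hħ, false_or]
  refine forall₂_congr fun t _ => ⟨fun ⟨hw, h1, h0⟩ v a b hv => ?_, fun h => ⟨fun k hk =>
    h _ _ _ (isTrivialDirection_vecW t hk), h _ _ _ (isTrivialDirection_vecU_neg_one t),
    h _ _ _ (isTrivialDirection_vecU_zero t)⟩⟩
  have h2 : fderiv ℂ f t (v - a • vecU 0 t - b • vecU (-1) t) = 0 := by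
    refine apply_eq_zero_of_odd_eq_zero hw fun j => ?_
    rw [irregTime_sub_smul_sub_smul, hv j, irregTime_vecU_zero, irregTime_vecU_neg_one]
    push_cast
    ring
  rw [map_sub, map_sub, map_smul, map_smul, h0, h1] at h2
  simpa using h2

section Branch

variable {ħ : ℂ} {U : Set (IrregularTimes g)} {s : IrregularTimes g → ℂ}

lemma IsRootBranch.fderiv_coordsOf_fderiv_timesOf (hU : IsOpen U) (hs : IsRootBranch U s)
    {t : IrregularTimes g} (ht : t ∈ U) (z : TimeCoordinates g) :
    fderiv ℂ (coordsOf s) t (fderiv ℂ timesOf (coordsOf s t) z) = z := by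
  have h1 := (differentiable_timesOf (coordsOf s t)).hasFDerivAt
  have h2 : HasFDerivAt (coordsOf s) (fderiv ℂ (coordsOf s) t) (timesOf (coordsOf s t)) := by
    rw [hs.timesOf_coordsOf ht]
    exact (hs.differentiableOn_coordsOf.differentiableAt (hU.mem_nhds ht)).hasFDerivAt
  have h3 := (h2.comp _ h1).unique ((hasFDerivAt_id _).congr_of_eventuallyEq
    (hs.eventually_coordsOf_timesOf hU ht))
  exact congrArg (fun φ => φ z) h3

lemma IsRootBranch.fderiv_timesOf_fderiv_coordsOf (hU : IsOpen U) (hs : IsRootBranch U s)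
    {t : IrregularTimes g} (ht : t ∈ U) (v : IrregularTimes g) :
    fderiv ℂ timesOf (coordsOf s t) (fderiv ℂ (coordsOf s) t v) = v := by
  have h1 := (differentiable_timesOf (coordsOf s t)).hasFDerivAt
  have h2 := (hs.differentiableOn_coordsOf.differentiableAt (hU.mem_nhds ht)).hasFDerivAt
  have h3 := (h1.comp _ h2).unique ((hasFDerivAt_id _).congr_of_eventuallyEq
    ((hU.eventually_mem ht).mono fun t' ht' => hs.timesOf_coordsOf ht'))
  exact congrArg (fun φ => φ v) h3

lemma IsRootBranch.fderiv_isoTimes (hU : IsOpen U) (hs : IsRootBranch U s)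
    {t : IrregularTimes g} (ht : t ∈ U) (v : IrregularTimes g) :
    fderiv ℂ (isoTimes s) t v = (fderiv ℂ (coordsOf s) t v).2 := by
  have h := (hs.differentiableOn_coordsOf.differentiableAt (hU.mem_nhds ht)).hasFDerivAt.snd
  rw [show isoTimes s = fun t => (coordsOf s t).2 from rfl, h.fderiv]
  rfl

/-- The isomonodromic times are constant along the trivial directions, and these are the only
directions with this property. -/
lemma IsRootBranch.fderiv_isoTimes_eq_zero_iff (hU : IsOpen U) (hs : IsRootBranch U s)
    {t : IrregularTimes g} (ht : t ∈ U) (v : IrregularTimes g) :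
    fderiv ℂ (isoTimes s) t v = 0 ↔ ∃ a b, IsTrivialDirection t v a b := by
  have h0 : (coordsOf s t).1.2.2 ≠ 0 := hs.s_ne_zero ht
  have ht' := hs.timesOf_coordsOf ht
  rw [hs.fderiv_isoTimes hU ht]
  constructor
  · intro h
    have h1 := isTrivialDirection_fderiv_timesOf h0 (fderiv ℂ (coordsOf s) t v).1
    have h2 : ((fderiv ℂ (coordsOf s) t v).1, (0 : Fin g → ℂ)) = fderiv ℂ (coordsOf s) t v :=
      Prod.ext rfl h.symm
    rw [h2, hs.fderiv_timesOf_fderiv_coordsOf hU ht, ht'] at h1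
    exact ⟨_, _, h1⟩
  · rintro ⟨a, b, h⟩
    rw [← ht'] at h
    obtain ⟨y, rfl⟩ := h.exists_fderiv_timesOf h0
    rw [hs.fderiv_coordsOf_fderiv_timesOf hU ht]

/-- The trivial and isomonodromic times are local coordinates. -/
lemma IsRootBranch.bijective_fderiv_allTimes (hU : IsOpen U) (hs : IsRootBranch U s)
    {t : IrregularTimes g} (ht : t ∈ U) : Function.Bijective (fderiv ℂ (allTimes s) t) := by
  have hd := (hs.differentiableOn_coordsOf.differentiableAt (hU.mem_nhds ht)).hasFDerivAt
  set D := fderiv ℂ (coordsOf s) t with hD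
  -- `allTimes` is obtained from `coordsOf` by squaring one coordinate
  have hcoord : ∀ k, DifferentiableAt ℂ (fun t => allTimes s t k) t := by
    rintro ((k | k) | k)
    · exact (differentiable_irregTime _).differentiableAt
    · fin_cases k
      · exact hs.differentiableOn_timeT1.differentiableAt (hU.mem_nhds ht)
      · exact hs.differentiableOn_timeT2.differentiableAt (hU.mem_nhds ht)
    · exact differentiableAt_pi.mp
        (hs.differentiableOn_isoTimes.differentiableAt (hU.mem_nhds ht)) k
  have hall := (differentiableAt_pi.mpr hcoord).hasFDerivAt
  have happ : ∀ k v, fderiv ℂ (allTimes s) t v k = fderiv ℂ (fun t => allTimes s t k) t v := by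
    intro k v
    rw [fderiv_apply (differentiableAt_pi.mpr hcoord)]
    rfl
  have hinj : Function.Injective (fderiv ℂ (allTimes s) t) := by
    rw [injective_iff_map_eq_zero]
    intro v hv
    have hz : ∀ k, fderiv ℂ (fun t => allTimes s t k) t v = 0 := fun k => by
      rw [← happ, hv]
      rfl
    have hDv : D v = 0 := by
      refine Prod.ext (Prod.ext (funext fun k => ?_) (Prod.ext ?_ ?_)) (funext fun k => ?_)
      · have h := (hasFDerivAt_pi'.mp hd.fst.fst k).fderiv
        have h1 := hz (Sum.inl (Sum.inl k))
        rw [show (fun t => allTimes s t (Sum.inl (Sum.inl k))) =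
          fun t => (coordsOf s t).1.1 k from rfl, h] at h1
        exact h1
      · have h := hd.fst.snd.fst.fderiv
        have h1 := hz (Sum.inl (Sum.inr 0))
        rw [show (fun t => allTimes s t (Sum.inl (Sum.inr 0))) =
          fun t => (coordsOf s t).1.2.1 from rfl, h] at h1
        exact h1
      · have h := (hd.fst.snd.snd.pow 2).fderiv
        have h1 := hz (Sum.inl (Sum.inr 1))
        rw [show (fun t => allTimes s t (Sum.inl (Sum.inr 1))) =
          fun t => (coordsOf s t).1.2.2 ^ 2 from rfl, h] at h1
        have h0 : (coordsOf s t).1.2.2 ≠ 0 := hs.s_ne_zero ht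
        simpa [h0] using h1
      · have h := (hasFDerivAt_pi'.mp hd.snd k).fderiv
        have h1 := hz (Sum.inr k)
        rw [show (fun t => allTimes s t (Sum.inr k)) =
          fun t => (coordsOf s t).2 k from rfl, h] at h1
        exact h1
    rw [← hs.fderiv_timesOf_fderiv_coordsOf hU ht v, ← hD, hDv, map_zero]
  refine ⟨hinj, ?_⟩
  have hfin : Module.finrank ℂ (IrregularTimes g) =
      Module.finrank ℂ ((Fin (g + 2) ⊕ Fin 2) ⊕ Fin g → ℂ) := by
    simp
    omega
  exact (LinearMap.injective_iff_surjective_of_finrank_eq_finrank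
    (f := (fderiv ℂ (allTimes s) t).toLinearMap) hfin).mp hinj

end Branch

end

/-! ### Functions of the isomonodromic times -/

section

variable {g : ℕ}

/-- Near every point `t₀` of `U`, the function `f` only depends on the isomonodromic times: its
value at `t` is its value at the point with the same isomonodromic times as `t` and the same trivial
times as `t₀`. -/
def FactorsLocally (U : Set (IrregularTimes g)) (s f : IrregularTimes g → ℂ) : Prop :=
  ∀ t₀ ∈ U, ∀ᶠ t in 𝓝 t₀, f t = f (timesOf ((coordsOf s t₀).1, isoTimes s t))

variable {ħ : ℂ} {U : Set (IrregularTimes g)} {s f : IrregularTimes g → ℂ}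

/-- A product of two balls around the coordinates of a point of `U` on which `timesOf` inverts
`coordsOf`. -/
lemma IsRootBranch.exists_ball (hU : IsOpen U) (hs : IsRootBranch U s) {t₀ : IrregularTimes g}
    (ht₀ : t₀ ∈ U) :
    ∃ r > 0, ∀ y ∈ Metric.ball (coordsOf s t₀).1 r, ∀ c ∈ Metric.ball (isoTimes s t₀) r,
      timesOf (y, c) ∈ U ∧ coordsOf s (timesOf (y, c)) = (y, c) := by
  obtain ⟨r, hr, h⟩ := Metric.eventually_nhds_iff_ball.mp
    ((hs.eventually_timesOf hU ht₀).and (hs.eventually_coordsOf_timesOf hU ht₀))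
  refine ⟨r, hr, fun y hy c hc => ?_⟩
  have h1 := h (y, c) (by
    rw [← Prod.mk.eta (p := coordsOf s t₀), ← ball_prod_same]
    exact ⟨hy, hc⟩)
  exact ⟨h1.1.1, h1.2⟩

/-- If `f (timesOf (y, c))` is independent of `y` near the coordinates of each point, then `f` only
depends on the isomonodromic times. -/
lemma IsRootBranch.factorsLocally (hU : IsOpen U) (hs : IsRootBranch U s)
    (h : ∀ t₀ ∈ U, ∀ r > 0, (∀ y ∈ Metric.ball (coordsOf s t₀).1 r,
      ∀ c ∈ Metric.ball (isoTimes s t₀) r,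
        timesOf (y, c) ∈ U ∧ coordsOf s (timesOf (y, c)) = (y, c)) →
      ∀ y ∈ Metric.ball (coordsOf s t₀).1 r, ∀ c ∈ Metric.ball (isoTimes s t₀) r,
        f (timesOf (y, c)) = f (timesOf ((coordsOf s t₀).1, c))) :
    FactorsLocally U s f := by
  intro t₀ ht₀
  obtain ⟨r, hr, hball⟩ := hs.exists_ball hU ht₀
  have hcont : ContinuousAt (coordsOf s) t₀ :=
    (hs.differentiableOn_coordsOf.continuousOn).continuousAt (hU.mem_nhds ht₀)
  filter_upwards [hU.mem_nhds ht₀, hcont.fst.eventually_mem (Metric.ball_mem_nhds _ hr),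
    hcont.snd.eventually_mem (Metric.ball_mem_nhds _ hr)] with t ht h1 h2
  exact (congrArg f (hs.timesOf_coordsOf ht).symm).trans (h t₀ ht₀ r hr hball _ h1 _ h2)

/-- Annihilation by the trivial deformations means that `f (timesOf (y, c))` has derivative zero in
the trivial coordinates `y`. -/
lemma IsAnnihilated.hasFDerivAt_comp_timesOf (hħ : ħ ≠ 0) (hU : IsOpen U)
    (hf : DifferentiableOn ℂ f U) (hann : IsAnnihilated ħ U f)
    {y : (Fin (g + 2) → ℂ) × ℂ × ℂ} {c : Fin g → ℂ} (hy : timesOf (y, c) ∈ U) (h0 : y.2.2 ≠ 0) :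
    HasFDerivAt (fun y => f (timesOf (y, c)))
      (0 : ((Fin (g + 2) → ℂ) × ℂ × ℂ) →L[ℂ] ℂ) y := by
  have h1 := (hf.differentiableAt (hU.mem_nhds hy)).hasFDerivAt
  have h2 := (differentiable_timesOf (y, c)).hasFDerivAt
  have h3 := HasFDerivAt.comp (g := f) (f := fun y => timesOf (y, c)) y h1
    (HasFDerivAt.comp (g := timesOf) (f := fun y => (y, c)) y h2 (hasFDerivAt_prodMk_left y c))
  refine h3.congr_fderiv (ContinuousLinearMap.ext fun w => ?_)
  exact (isAnnihilated_iff hħ).mp hann _ hy _ _ _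
    (isTrivialDirection_fderiv_timesOf (x := (y, c)) h0 w)

lemma IsAnnihilated.eq_of_mem_ball (hħ : ħ ≠ 0) (hU : IsOpen U) (hs : IsRootBranch U s)
    (hf : DifferentiableOn ℂ f U) (hann : IsAnnihilated ħ U f)
    {y₀ : (Fin (g + 2) → ℂ) × ℂ × ℂ} {r : ℝ} (hr : 0 < r) {c : Fin g → ℂ}
    (h : ∀ y ∈ Metric.ball y₀ r, timesOf (y, c) ∈ U ∧ coordsOf s (timesOf (y, c)) = (y, c))
    {y : (Fin (g + 2) → ℂ) × ℂ × ℂ} (hy : y ∈ Metric.ball y₀ r) :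
    f (timesOf (y, c)) = f (timesOf (y₀, c)) := by
  have hD : ∀ y ∈ Metric.ball y₀ r, HasFDerivAt (fun y => f (timesOf (y, c)))
      (0 : ((Fin (g + 2) → ℂ) × ℂ × ℂ) →L[ℂ] ℂ) y := fun y hy => by
    obtain ⟨h1, h2⟩ := h y hy
    refine hann.hasFDerivAt_comp_timesOf hħ hU hf h1 ?_
    rw [show y = (coordsOf s (timesOf (y, c))).1 by rw [h2]]
    exact hs.s_ne_zero h1
  exact Metric.isOpen_ball.is_const_of_fderiv_eq_zero (convex_ball y₀ r).isPreconnected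
    (fun y hy => (hD y hy).differentiableAt.differentiableWithinAt) (fun y hy => (hD y hy).fderiv)
    hy (Metric.mem_ball_self hr)

lemma IsAnnihilated.factorsLocally (hħ : ħ ≠ 0) (hU : IsOpen U) (hs : IsRootBranch U s)
    (hf : DifferentiableOn ℂ f U) (hann : IsAnnihilated ħ U f) : FactorsLocally U s f :=
  hs.factorsLocally hU fun _ _ _ hr hball _ hy _ hc =>
    hann.eq_of_mem_ball hħ hU hs hf hr (fun y hy => hball y hy _ hc) hy

lemma FactorsLocally.isFunctionOfIsoTimes (hU : IsOpen U) (hs : IsRootBranch U s)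
    (hf : DifferentiableOn ℂ f U) (hfac : FactorsLocally U s f) : IsFunctionOfIsoTimes U s f := by
  have hdiff : ∀ y c, timesOf (y, c) ∈ U →
      DifferentiableAt ℂ (fun c => f (timesOf (y, c))) c := fun y c hc => by
    have h1 := hf.differentiableAt (hU.mem_nhds hc)
    have h2 : DifferentiableAt ℂ (fun c => timesOf (y, c)) c :=
      (differentiable_timesOf (y, c)).comp c (by fun_prop)
    exact DifferentiableAt.comp (f := fun c => timesOf (y, c)) c h1 h2
  have hτ : ∀ t₀ ∈ U, ContinuousAt (isoTimes s) t₀ := fun t₀ ht₀ =>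
    (hs.differentiableOn_isoTimes.continuousOn).continuousAt (hU.mem_nhds ht₀)
  constructor
  · intro t₀ ht₀
    obtain ⟨r, hr, hball⟩ := hs.exists_ball hU ht₀
    have hev := (hfac t₀ ht₀).and ((hU.eventually_mem ht₀).and
      ((hτ t₀ ht₀).eventually_mem (Metric.ball_mem_nhds _ hr)))
    obtain ⟨V, hV, hVo, htV⟩ := eventually_nhds_iff.mp hev
    refine ⟨V, hVo, htV, fun t ht => (hV t ht).2.1,
      fun c => f (timesOf ((coordsOf s t₀).1, c)), ?_, fun t ht => (hV t ht).1⟩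
    rintro _ ⟨t, ht, rfl⟩
    exact (hdiff _ _ (hball _ (Metric.mem_ball_self hr) _
      (hV t ht).2.2).1).differentiableWithinAt
  · intro V hVo hVU hconn
    -- `f` is locally constant on the level sets of the isomonodromic times
    have hconst : ∀ t ∈ V, ∀ t' ∈ V, isoTimes s t = isoTimes s t' → f t = f t' := by
      intro t ht t' ht' htt'
      have := isPreconnected_iff_preconnectedSpace.mp (hconn (isoTimes s t'))
      have hloc : IsLocallyConstant
          (fun x : {t ∈ V | isoTimes s t = isoTimes s t'} => f x.1) := by
        rw [IsLocallyConstant.iff_eventually_eq]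
        rintro ⟨x, hxV, hx⟩
        have h1 := hfac x (hVU hxV)
        filter_upwards [continuous_subtype_val.continuousAt.eventually h1] with z hz
        have h2 := h1.self_of_nhds
        rw [hz, z.2.2, h2, hx]
      exact hloc.apply_eq_of_preconnectedSpace ⟨t, ht, htt'⟩ ⟨t', ht', rfl⟩
    classical
    refine ⟨fun c => if h : ∃ t ∈ V, isoTimes s t = c then f h.choose else 0, ?_, fun t ht => ?_⟩
    · rintro _ ⟨t₀, ht₀, rfl⟩
      obtain ⟨r, hr, hball⟩ := (hs.mono hVU).exists_ball hVo ht₀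
      refine (DifferentiableAt.congr_of_eventuallyEq (hdiff (coordsOf s t₀).1 _ (by
        exact (hs.timesOf_coordsOf (hVU ht₀)).symm ▸ hVU ht₀)) ?_).differentiableWithinAt
      filter_upwards [Metric.ball_mem_nhds (isoTimes s t₀) hr] with c hc
      obtain ⟨h1, h2⟩ := hball _ (Metric.mem_ball_self hr) c hc
      have hex : ∃ t ∈ V, isoTimes s t = c := ⟨_, h1, congrArg Prod.snd h2⟩
      rw [dif_pos hex]
      exact hconst _ hex.choose_spec.1 _ h1 (hex.choose_spec.2.trans (congrArg Prod.snd h2).symm)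
    · have hex : ∃ t' ∈ V, isoTimes s t' = isoTimes s t := ⟨t, ht, rfl⟩
      simp only
      rw [dif_pos hex]
      exact hconst _ ht _ hex.choose_spec.1 hex.choose_spec.2.symm

/-- A function which locally is a holomorphic function of the isomonodromic times is annihilated by
the trivial deformations: the isomonodromic times form a submersion, so the chain rule applies. -/
lemma isAnnihilated_of_locally (hħ : ħ ≠ 0) (hs : IsRootBranch U s)
    (h : ∀ t₀ ∈ U, ∃ V, IsOpen V ∧ t₀ ∈ V ∧ V ⊆ U ∧ EqFunctionOfIsoTimes V s f) :
    IsAnnihilated ħ U f := by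
  rw [isAnnihilated_iff hħ]
  intro t₀ ht₀ v a b hv
  obtain ⟨V, hVo, htV, hVU, u, hu, hfu⟩ := h t₀ ht₀
  have hsV := hs.mono hVU
  obtain ⟨r, hr, hball⟩ := hsV.exists_ball hVo htV
  have hnhds : isoTimes s '' V ∈ 𝓝 (isoTimes s t₀) := by
    filter_upwards [Metric.ball_mem_nhds (isoTimes s t₀) hr] with c hc
    obtain ⟨h1, h2⟩ := hball _ (Metric.mem_ball_self hr) c hc
    exact ⟨_, h1, congrArg Prod.snd h2⟩
  have h1 := (hu.differentiableAt hnhds).hasFDerivAt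
  have h2 := (hsV.differentiableOn_isoTimes.differentiableAt (hVo.mem_nhds htV)).hasFDerivAt
  have h3 := (h1.comp t₀ h2).congr_of_eventuallyEq
    ((hVo.eventually_mem htV).mono fun t ht => hfu t ht)
  have h4 := (hsV.fderiv_isoTimes_eq_zero_iff hVo htV v).mpr ⟨a, b, hv⟩
  rw [h3.fderiv, ContinuousLinearMap.comp_apply, h4, map_zero]

lemma isAnnihilated_iff_isFunctionOfIsoTimes (hħ : ħ ≠ 0) (hU : IsOpen U) (hs : IsRootBranch U s)
    (hf : DifferentiableOn ℂ f U) : IsAnnihilated ħ U f ↔ IsFunctionOfIsoTimes U s f :=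
  ⟨fun h => (h.factorsLocally hħ hU hs hf).isFunctionOfIsoTimes hU hs hf,
    fun h => isAnnihilated_of_locally hħ hs h.1⟩

lemma IsAnnihilated.isIndependentOfTrivialTimes (hħ : ħ ≠ 0) (hU : IsOpen U)
    (hs : IsRootBranch U s) (hf : DifferentiableOn ℂ f U) (hann : IsAnnihilated ħ U f) :
    IsIndependentOfTrivialTimes U s f := by
  refine ⟨hf, fun t ht i v hv => ?_⟩
  have hall : DifferentiableAt ℂ (allTimes s) t := by
    by_contra hnd
    have := hs.bijective_fderiv_allTimes hU ht
    rw [fderiv_zero_of_not_differentiableAt hnd] at this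
    have h1 : (Pi.single (Sum.inl i) 1 : (Fin (g + 2) ⊕ Fin 2) ⊕ Fin g → ℂ) = 0 := by
      obtain ⟨w, hw⟩ := this.2 (Pi.single (Sum.inl i) 1)
      simpa using hw.symm
    simpa using congrFun h1 (Sum.inl i)
  have h0 : fderiv ℂ (isoTimes s) t v = 0 := by
    have hτ := hs.differentiableOn_isoTimes.differentiableAt (hU.mem_nhds ht)
    ext k
    have e1 := congrArg (fun φ => φ v) (fderiv_apply hall (Sum.inr k))
    have e2 := congrArg (fun φ => φ v) (fderiv_apply hτ k)
    have e3 : fderiv ℂ (allTimes s) t v (Sum.inr k) = 0 := by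
      rw [hv]
      simp
    exact (e2.symm.trans e1).trans e3
  obtain ⟨a, b, h1⟩ := (hs.fderiv_isoTimes_eq_zero_iff hU ht v).mp h0
  exact (isAnnihilated_iff hħ).mp hann t ht v a b h1

/-! ### The shifted Darboux coordinates -/

section Darboux

variable {L : IrregularTimes g → Matrix (Fin 2) (Fin 2) ℂ[X]} {q : Fin g → IrregularTimes g → ℂ}

lemma IsDarbouxPosition.differentiableOn_shiftedQ (hs : IsRootBranch U s)
    (hq : IsDarbouxPosition U L q) (j : Fin g) : DifferentiableOn ℂ (shiftedQ s q j) U :=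
  (hs.differentiableOn_timeT2.mul (hq.differentiableOn j)).add hs.differentiableOn_timeT1

lemma unshift_shiftedQ (hs : IsRootBranch U s) {t : IrregularTimes g} (ht : t ∈ U) (j : Fin g) :
    unshift s (shiftedQ s q j t) t = q j t := by
  have := hs.timeT2_ne_zero ht
  rw [unshift, shiftedQ]
  field_simp
  ring

/-- In the shifted spectral parameter, the rescaled entry `L₁₂` has the shifted Darboux coordinates
as its roots. -/
lemma IsDarbouxPosition.prod_shiftedQ (hs : IsRootBranch U s) (hq : IsDarbouxPosition U L q)
    {t : IrregularTimes g} (ht : t ∈ U) (x : ℂ) :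
    timeT2 s t ^ (g : ℤ) * (L t 0 1).eval (unshift s x t) = ∏ j, (x - shiftedQ s q j t) := by
  have h0 := hs.timeT2_ne_zero ht
  rw [hq.zeros t ht, eval_prod, zpow_natCast]
  have hc : timeT2 s t ^ g = ∏ _j : Fin g, timeT2 s t := by simp
  rw [hc, ← Finset.prod_mul_distrib]
  refine Finset.prod_congr rfl fun j _ => ?_
  rw [eval_sub, eval_X, eval_C, unshift, shiftedQ]
  field_simp
  ring

lemma IsIsomonodromicFamily.shiftedP_eq (hħ : ħ ≠ 0) (hs : IsRootBranch U s)
    (hL : IsIsomonodromicFamily ħ U L) {t : IrregularTimes g} (ht : t ∈ U) (j : Fin g) :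
    shiftedP s L q j t = 1 / 2 * (timeT2 s t ^ (-1 : ℤ) *
      (L t 0 0 - L t 1 1).eval (unshift s (shiftedQ s q j t) t)) := by
  have htr := ((hL.irregularType t ht).trace_discr hħ (hs.ne_zero t ht) (hL.normalized t ht)).1
  have hP1 : P1 t (q j t) = (L t 0 0 + L t 1 1).eval (q j t) := by
    rw [eval_eq_sum_of_coeff_eq_zero (N := g + 2), P1, ← Finset.sum_neg_distrib]
    · exact Finset.sum_congr rfl fun n _ => by rw [htr, neg_mul]
    · intro n hn
      rw [htr, irregTime_of_lt t (by omega), neg_zero]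
  rw [unshift_shiftedQ hs ht, shiftedP, darbouxMomentum, hP1, zpow_neg_one, eval_add, eval_sub]
  ring

/-- Along the trivial directions the shifted Darboux coordinates are continuous roots of a fixed
polynomial, hence constant. No separation of the roots is needed. -/
lemma IsIsomonodromicFamily.factorsLocally_shifted (hħ : ħ ≠ 0) (hU : IsOpen U)
    (hs : IsRootBranch U s) (hL : IsIsomonodromicFamily ħ U L) (hq : IsDarbouxPosition U L q)
    (j : Fin g) :
    FactorsLocally U s (shiftedQ s q j) ∧ FactorsLocally U s (shiftedP s L q j) := by
  have hQ : ∀ t₀ ∈ U, ∀ r > 0, (∀ y ∈ Metric.ball (coordsOf s t₀).1 r,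
      ∀ c ∈ Metric.ball (isoTimes s t₀) r,
        timesOf (y, c) ∈ U ∧ coordsOf s (timesOf (y, c)) = (y, c)) →
      ∀ y ∈ Metric.ball (coordsOf s t₀).1 r, ∀ c ∈ Metric.ball (isoTimes s t₀) r,
        shiftedQ s q j (timesOf (y, c)) = shiftedQ s q j (timesOf ((coordsOf s t₀).1, c)) := by
    intro t₀ _ r hr hball y hy c hc
    set y₀ := (coordsOf s t₀).1
    have hroots : ∀ y ∈ Metric.ball y₀ r, shiftedQ s q j (timesOf (y, c)) ∈
        (Set.range fun i => shiftedQ s q i (timesOf (y₀, c))) := by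
      intro y hy
      obtain ⟨hd, ha⟩ := hL.isAnnihilated_shifted_zero_one hħ hU hs
        (shiftedQ s q j (timesOf (y, c)))
      have h1 := ha.eq_of_mem_ball hħ hU hs hd hr (fun y hy => hball y hy c hc) hy
      rw [hq.prod_shiftedQ hs (hball y hy c hc).1,
        hq.prod_shiftedQ hs (hball y₀ (Metric.mem_ball_self hr) c hc).1,
        Finset.prod_eq_zero (Finset.mem_univ j) (sub_self _)] at h1
      obtain ⟨i, -, hi⟩ := Finset.prod_eq_zero_iff.mp h1.symm
      exact ⟨i, (sub_eq_zero.mp hi).symm⟩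
    have hcont : ContinuousOn (fun y => shiftedQ s q j (timesOf (y, c))) (Metric.ball y₀ r) := by
      have h1 : Continuous fun y : (Fin (g + 2) → ℂ) × ℂ × ℂ => timesOf (y, c) :=
        differentiable_timesOf.continuous.comp (by fun_prop)
      exact (hq.differentiableOn_shiftedQ hs j).continuousOn.comp h1.continuousOn
        fun y hy => (hball y hy c hc).1
    have hfin := Set.finite_range fun i => shiftedQ s q i (timesOf (y₀, c))
    exact (convex_ball y₀ r).isPreconnected.constant_of_mapsTo hfin.isDiscrete hcont hroots hy
      (Metric.mem_ball_self hr)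
  refine ⟨hs.factorsLocally hU hQ, hs.factorsLocally hU ?_⟩
  intro t₀ ht₀ r hr hball y hy c hc
  obtain ⟨hd, ha⟩ := hL.isAnnihilated_shifted_diagonal hħ hU hs
    (shiftedQ s q j (timesOf ((coordsOf s t₀).1, c)))
  have h1 := ha.eq_of_mem_ball hħ hU hs hd hr (fun y hy => hball y hy c hc) hy
  rw [hL.shiftedP_eq hħ hs (hball y hy c hc).1,
    hL.shiftedP_eq hħ hs (hball _ (Metric.mem_ball_self hr) c hc).1, hQ t₀ ht₀ r hr hball y hy c hc]
  exact congrArg _ h1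

lemma IsIsomonodromicFamily.differentiableOn_shiftedP (hħ : ħ ≠ 0)
    (hs : IsRootBranch U s) (hL : IsIsomonodromicFamily ħ U L) (hq : IsDarbouxPosition U L q)
    (j : Fin g) : DifferentiableOn ℂ (shiftedP s L q j) U := by
  have h : DifferentiableOn ℂ (fun t => 1 / 2 * (timeT2 s t ^ (-1 : ℤ) *
      (L t 0 0 - L t 1 1).eval (q j t))) U :=
    ((hs.differentiableOn_timeT2.zpow (Or.inl fun t ht => hs.timeT2_ne_zero ht)).mul
      (differentiableOn_eval (N := g) (fun n => by
        simpa only [coeff_sub] using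
          (hL.differentiableOn 0 0 n).fun_sub (hL.differentiableOn 1 1 n))
        (fun t ht n hn => (hL.normalized t ht).coeff_sub hn) (hq.differentiableOn j))).const_mul _
  refine h.congr fun t ht => ?_
  rw [hL.shiftedP_eq hħ hs ht, unshift_shiftedQ hs ht]

end Darboux

/-! ### The principal branch -/

lemma isOpen_principalDomain (g : ℕ) : IsOpen (principalDomain g) := by
  have h : Continuous fun t : IrregularTimes g => irregTime t (2 * g + 3) / 2 :=
    (differentiable_irregTime _).continuous.div_const 2
  exact Complex.isOpen_slitPlane.preimage h

lemma isRootBranch_principalRoot (g : ℕ) :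
    IsRootBranch (principalDomain g) (principalRoot (g := g)) := by
  have hg : (2 * (g : ℂ) + 3) ≠ 0 := by exact_mod_cast (by omega : 2 * g + 3 ≠ 0)
  refine ⟨fun t ht h => ?_, fun t _ => ?_, fun t ht => ?_⟩
  · exact Complex.slitPlane_ne_zero ht (by rw [h, zero_div])
  · rw [principalRoot, ← Complex.cpow_nat_mul]
    push_cast
    rw [mul_one_div_cancel hg, Complex.cpow_one]
  · have h : DifferentiableAt ℂ (fun t : IrregularTimes g => irregTime t (2 * g + 3) / 2) t := by
      simpa only [div_eq_mul_inv] using (differentiable_irregTime (2 * g + 3) t).mul_const _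
    exact (h.cpow (differentiableAt_const _) ht).differentiableWithinAt

/-- The value of the principal root at the points of the path which contracts a fibre of the
isomonodromic times. -/
lemma principalRoot_timesOf {t : IrregularTimes g} (ht : t ∈ principalDomain g) {r : ℝ}
    (hr0 : 0 ≤ r) (hr1 : r ≤ 1) {x : TimeCoordinates g}
    (hx : x.1.2.2 = Complex.exp (r * (Complex.log (irregTime t (2 * g + 3) / 2) /
      (2 * (g : ℂ) + 3)))) :
    timesOf x ∈ principalDomain g ∧ principalRoot (timesOf x) = x.1.2.2 := by
  have hg : (2 * (g : ℂ) + 3) ≠ 0 := by exact_mod_cast (by omega : 2 * g + 3 ≠ 0)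
  set l := Complex.log (irregTime t (2 * g + 3) / 2) with hl
  have htop : irregTime (timesOf x) (2 * g + 3) / 2 = Complex.exp (r * l) := by
    rw [irregTime_timesOf_top, hx, ← Complex.exp_nat_mul]
    congr 1
    push_cast
    field_simp
  have him : (r * l : ℂ).im = r * l.im := Complex.im_ofReal_mul _ _
  have harg : |l.im| < Real.pi := by
    rw [hl, Complex.log_im]
    exact abs_lt.mpr ⟨Complex.neg_pi_lt_arg _,
      (Complex.arg_le_pi _).lt_of_ne (Complex.slitPlane_arg_ne_pi ht)⟩
  have hlt : |(r * l : ℂ).im| < Real.pi := by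
    rw [him, abs_mul, abs_of_nonneg hr0]
    exact (mul_le_of_le_one_left (abs_nonneg _) hr1).trans_lt harg
  obtain ⟨h1, h2⟩ := abs_lt.mp hlt
  have hlog : Complex.log (Complex.exp (r * l)) = r * l := Complex.log_exp h1 h2.le
  constructor
  · rw [principalDomain, Set.mem_ofPred_eq, htop, Complex.mem_slitPlane_iff_arg]
    refine ⟨?_, Complex.exp_ne_zero _⟩
    rw [← Complex.log_im, hlog]
    exact h2.ne
  · rw [principalRoot, htop, Complex.cpow_def_of_ne_zero (Complex.exp_ne_zero _), hlog, hx]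
    congr 1
    ring

end

section

variable {g : ℕ} {ħ : ℂ} {f : IrregularTimes g → ℂ}

/-- On the principal domain, the trivial times can be contracted to `(0, 0, 1)` at fixed
isomonodromic times, along `r ↦ (r e, r T₁, exp (r log s))`, without leaving the domain. Functions
annihilated by the trivial deformations are constant along this path. -/
lemma IsAnnihilated.eq_timesOf_isoTimes (hħ : ħ ≠ 0)
    (hf : DifferentiableOn ℂ f (principalDomain g)) (hann : IsAnnihilated ħ (principalDomain g) f)
    {t : IrregularTimes g} (ht : t ∈ principalDomain g) :
    f t = f (timesOf ((0, 0, 1), isoTimes principalRoot t)) := by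
  set c := isoTimes principalRoot t
  set e := (coordsOf principalRoot t).1 with he
  set l := Complex.log (irregTime t (2 * g + 3) / 2) / (2 * (g : ℂ) + 3) with hl
  set γ : ℝ → (Fin (g + 2) → ℂ) × ℂ × ℂ := fun r =>
    ((r : ℂ) • e.1, (r : ℂ) * e.2.1, Complex.exp (r * l)) with hγ
  have hmem : ∀ r ∈ Set.Icc (0 : ℝ) 1, timesOf (γ r, c) ∈ principalDomain g := fun r hr =>
    (principalRoot_timesOf ht hr.1 hr.2 rfl).1
  have hγd : Differentiable ℝ γ := by
    have h : Differentiable ℝ (fun r : ℝ => (r : ℂ)) := Complex.ofRealCLM.differentiable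
    have h1 : Differentiable ℝ (fun r : ℝ => (r : ℂ) • e.1) := h.smul_const e.1
    have h2 : Differentiable ℝ (fun r : ℝ => (r : ℂ) * e.2.1) := h.mul_const e.2.1
    exact h1.prodMk (h2.prodMk (h.mul_const l).cexp)
  have hd : ∀ r ∈ Set.Icc (0 : ℝ) 1, HasDerivAt (fun r => f (timesOf (γ r, c))) 0 r := by
    intro r hr
    have h1 := (hann.hasFDerivAt_comp_timesOf hħ (isOpen_principalDomain g) hf (hmem r hr)
      (Complex.exp_ne_zero _)).restrictScalars ℝ
    exact (h1.comp_hasDerivAt r (hγd r).hasDerivAt).congr_deriv (by simp)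
  have hconst := constant_of_has_deriv_right_zero (f := fun r => f (timesOf (γ r, c)))
    (fun r hr => (hd r hr).continuousAt.continuousWithinAt)
    (fun r hr => (hd r (Set.Ico_subset_Icc_self hr)).hasDerivWithinAt) 1 (by simp)
  have h0 : γ 0 = (0, 0, 1) := by simp [hγ]
  have hg : irregTime t (2 * g + 3) / 2 ≠ 0 := Complex.slitPlane_ne_zero ht
  have h1 : γ 1 = e := by
    have h2 : Complex.exp l = e.2.2 := by
      rw [he, hl]
      change _ = principalRoot t
      rw [principalRoot, Complex.cpow_def_of_ne_zero hg, mul_one_div]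
    simp only [hγ, Complex.ofReal_one, one_smul, one_mul, h2]
  simp only [h0, h1] at hconst
  rw [← hconst]
  exact congrArg f ((isRootBranch_principalRoot g).timesOf_coordsOf ht).symm

lemma timesOf_mem_principalDomain (c : Fin g → ℂ) :
    timesOf ((0, 0, 1), c) ∈ principalDomain g := by
  rw [principalDomain, Set.mem_ofPred_eq, irregTime_timesOf_top]
  simp

lemma isAnnihilated_principalDomain_iff (hħ : ħ ≠ 0)
    (hf : DifferentiableOn ℂ f (principalDomain g)) :
    IsAnnihilated ħ (principalDomain g) f ↔ ∃ u : (Fin g → ℂ) → ℂ, Differentiable ℂ u ∧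
      ∀ t ∈ principalDomain g, f t = u (isoTimes principalRoot t) := by
  have hD := isOpen_principalDomain g
  constructor
  · intro hann
    refine ⟨fun c => f (timesOf ((0, 0, 1), c)), fun c => ?_, fun t ht =>
      hann.eq_timesOf_isoTimes hħ hf ht⟩
    have h1 := hf.differentiableAt (hD.mem_nhds (timesOf_mem_principalDomain c))
    have h2 : DifferentiableAt ℂ
        (fun c : Fin g → ℂ => timesOf (((0, 0, 1) : (Fin (g + 2) → ℂ) × ℂ × ℂ), c)) c :=
      (differentiable_timesOf (_, c)).comp c (by fun_prop)
    exact DifferentiableAt.comp (f := fun c => timesOf ((0, 0, 1), c)) c h1 h2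
  · rintro ⟨u, hu, hfu⟩
    exact isAnnihilated_of_locally hħ (isRootBranch_principalRoot g) fun t₀ ht₀ =>
      ⟨_, hD, ht₀, subset_rfl, u, hu.differentiableOn, hfu⟩

lemma IsRootBranch.isFunctionOfIsoTimes_shifted {U : Set (IrregularTimes g)}
    {s : IrregularTimes g → ℂ} {L : IrregularTimes g → Matrix (Fin 2) (Fin 2) ℂ[X]}
    {q : Fin g → IrregularTimes g → ℂ} (hħ : ħ ≠ 0) (hU : IsOpen U) (hs : IsRootBranch U s)
    (hL : IsIsomonodromicFamily ħ U L) (hq : IsDarbouxPosition U L q) (j : Fin g) :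
    IsFunctionOfIsoTimes U s (shiftedQ s q j) ∧ IsFunctionOfIsoTimes U s (shiftedP s L q j) :=
  have h := hL.factorsLocally_shifted hħ hU hs hq j
  ⟨h.1.isFunctionOfIsoTimes hU hs (hq.differentiableOn_shiftedQ hs j),
    h.2.isFunctionOfIsoTimes hU hs (hL.differentiableOn_shiftedP hħ hs hq j)⟩

lemma IsFunctionOfIsoTimes.isIndependentOfTrivialTimes {U : Set (IrregularTimes g)}
    {s : IrregularTimes g → ℂ} (hU : IsOpen U) (hs : IsRootBranch U s)
    (hf : DifferentiableOn ℂ f U) (h : IsFunctionOfIsoTimes U s f) :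
    IsIndependentOfTrivialTimes U s f :=
  ((isAnnihilated_iff_isFunctionOfIsoTimes one_ne_zero hU hs hf).mpr h).isIndependentOfTrivialTimes
    one_ne_zero hU hs hf

end

end TwistedIsomonodromy

end

open TwistedIsomonodromy in
theorem theorem6p2 (ħ : ℂ) (hħ : ħ ≠ 0) (g : ℕ) :
    -- on every open set carrying a branch of the root
    (∀ (U : Set (IrregularTimes g)) (s : IrregularTimes g → ℂ), IsOpen U → IsRootBranch U s →
      -- the trivial and isomonodromic times are local coordinates
      (∀ t ∈ U, Function.Bijective (fderiv ℂ (allTimes s) t)) ∧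
      -- the shifted Darboux coordinates depend only on the isomonodromic times
      (∀ (L : IrregularTimes g → Matrix (Fin 2) (Fin 2) (Polynomial ℂ))
          (q : Fin g → IrregularTimes g → ℂ),
        IsIsomonodromicFamily ħ U L → IsDarbouxPosition U L q →
        ∀ j : Fin g,
          (IsIndependentOfTrivialTimes U s (shiftedQ s q j) ∧
            IsIndependentOfTrivialTimes U s (shiftedP s L q j)) ∧
          (IsFunctionOfIsoTimes U s (shiftedQ s q j) ∧
            IsFunctionOfIsoTimes U s (shiftedP s L q j))) ∧
      -- the functions annihilated by the trivial deformations
      (∀ f : IrregularTimes g → ℂ, DifferentiableOn ℂ f U →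
        (IsAnnihilated ħ U f ↔ IsFunctionOfIsoTimes U s f))) ∧
    -- the same on the whole domain of the principal branch, with a single function `u`
    (∀ f : IrregularTimes g → ℂ, DifferentiableOn ℂ f (principalDomain g) →
      (IsAnnihilated ħ (principalDomain g) f ↔
        ∃ u : (Fin g → ℂ) → ℂ, Differentiable ℂ u ∧
          ∀ t ∈ principalDomain g, f t = u (isoTimes principalRoot t))) := by
  refine ⟨fun U s hU hs => ⟨fun t ht => hs.bijective_fderiv_allTimes hU ht, ?_, fun f hf =>
    isAnnihilated_iff_isFunctionOfIsoTimes hħ hU hs hf⟩, fun f hf =>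
    isAnnihilated_principalDomain_iff hħ hf⟩
  intro L q hL hq j
  have h := hs.isFunctionOfIsoTimes_shifted hħ hU hL hq j
  exact ⟨⟨h.1.isIndependentOfTrivialTimes hU hs (hq.differentiableOn_shiftedQ hs j),
    h.2.isIndependentOfTrivialTimes hU hs (hL.differentiableOn_shiftedP hħ hs hq j)⟩, h⟩
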